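/- Let $X\subset\mathbb R^d$ be a nonempty closed set and let $S_1,\dots,S_\ell:X\to X$ ($\ell\ge 1$) be injective contractions (each $S_i$ is Lipschitz with constant $<1$). Let $K$ be the attractor, i.e. the unique nonempty compact set $K\subset X$ with $K=\bigcup_{i}S_i(K)$. Let $\Sigma=\{1,\dots,\ell\}^{\mathbb N}$ with the left shift $\sigma$, and let $\pi:\Sigma\to K$ be the canonical projection, $\{\pi(x)\}=\bigcap_{n\ge1}S_{x_1}\circ\cdots\circ S_{x_n}(K)$. The space $\Sigma$ carries the product Borel $\sigma$-algebra and the metric $\rho(x,y)=\ell^{-n}$ for $x\ne y$, where $n$ is the length of the longest common initial word of $x$ and $y$. Let $m$ be a $\sigma$-invariant Borel probability measure on $\Sigma$. Let $\mathcal P=\{[1],\dots,[\ell]\}$, $[j]=\{x\in\Sigma: x_1=j\}$, let $\mathcal P_0^k=\bigvee_{i=0}^k\sigma^{-i}\mathcal P$, and let $\mathcal P_0^k(x)$ be the element of $\mathcal P_0^k$ containing $x$. For a sub-$\sigma$-algebra $\mathcal A$ put $$H_m(\mathcal P|\mathcal A)=-\int\sum_{A\in\mathcal P}\chi_A\log\mathbf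 E_m(\chi_A|\mathcal A)\,dm,$$ and define the projection entropy $$h_\pi(\sigma,m)=H_m(\mathcal P|\sigma^{-1}\pi^{-1}\gamma)-H_m(\mathcal P|\pi^{-1}\gamma),$$ where $\gamma$ is the Borel $\sigma$-algebra of $\mathbb R^d$. Let $h(\sigma,m)$ be the measure-theoretic (Kolmogorov–Sinai) entropy. Let $\{m_x^\eta\}_{x\in\Sigma}$ be the conditional measures of $m$ with respect to the partition $\eta=\{\pi^{-1}(z):z\in\mathbb R^d\}$ (the regular conditional probabilities of $m$ given $\pi^{-1}\gamma$). The Hausdorff dimension of a Borel probability measure $\mu$ on $\Sigma$ is $\dim_H\mu=\inf\{\dim_HA: A\subset\Sigma\text{ Borel},\ \mu(A)=1\}$. Then $$h_\pi(\sigma,m)=h(\sigma,m)\iff\lim_{k\to\infty}\frac1k\log m_x^\eta(\mathcal P_0^k(x))=0\ \text{ for $m$-a.e. }x\iff\dim_Hm_x^\eta=0\ \text{ for $m$-a.e. }x.$$ In particular, if $\dim_H\pi^{-1}(z)=0$ for every $z\in\mathbb R^d$, then $h_\pi(\sigma,m)=h(\sigma,m)$. -/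

import Mathlib

open MeasureTheory ProbabilityTheory Filter Topology Set
open scoped NNReal ENNReal

/-- An iterated function system of `ℓ ≥ 1` contractions of a nonempty closed set
`X ⊆ ℝ^d` into itself. -/
structure IFS (d ℓ : ℕ) where
  /-- the closed set on which the maps act -/
  X : Set (EuclideanSpace ℝ (Fin d))
  isClosed_X : IsClosed X
  nonempty_X : X.Nonempty
  card_pos : 0 < ℓ
  /-- the maps `S_i : X → X` -/
  S : Fin ℓ → X → X
  contracting : ∀ i, ∃ c : ℝ≥0, ContractingWith c (S i)

namespace IFS

variable {d ℓ : ℕ}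

/-- The maps of an IFS have a common contraction ratio. -/
theorem exists_ratio (Φ : IFS d ℓ) : ∃ c : ℝ≥0, c < 1 ∧ ∀ i, LipschitzWith c (Φ.S i) := by
  choose c hc using Φ.contracting
  have h1 : Finset.univ.sup c < 1 := by
    rw [Finset.sup_lt_iff (by simp)]
    exact fun i _ => (hc i).1
  exact ⟨_, h1, fun i => (hc i).2.weaken (Finset.le_sup (Finset.mem_univ i))⟩

/-- Hutchinson's theorem: there is exactly one nonempty compact `K ⊆ X` with
`K = ⋃ i, S_i(K)`. -/
theorem existsUnique_attractor (Φ : IFS d ℓ) :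
    ∃! K : Set Φ.X, K.Nonempty ∧ IsCompact K ∧ K = ⋃ i, Φ.S i '' K := by
  obtain ⟨c, hc, hS⟩ := Φ.exists_ratio
  have : CompleteSpace Φ.X := Φ.isClosed_X.completeSpace_coe
  have : Nonempty Φ.X := Φ.nonempty_X.to_subtype
  let i₀ : Fin ℓ := ⟨0, Φ.card_pos⟩
  let F : TopologicalSpace.NonemptyCompacts Φ.X → TopologicalSpace.NonemptyCompacts Φ.X := fun K =>
    ⟨⟨⋃ i, Φ.S i '' (K : Set Φ.X), isCompact_iUnion fun i => K.isCompact.image (hS i).continuous⟩,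
      (K.nonempty.image (Φ.S i₀)).mono (subset_iUnion (fun i => Φ.S i '' (K : Set Φ.X)) i₀)⟩
  have hFcoe : ∀ K, (F K : Set Φ.X) = ⋃ i, Φ.S i '' (K : Set Φ.X) := fun _ => rfl
  have key : ∀ A B : TopologicalSpace.NonemptyCompacts Φ.X, ∀ z ∈ (F A : Set Φ.X),
      ∃ w ∈ (F B : Set Φ.X), edist z w ≤ c * Metric.hausdorffEDist (A : Set Φ.X) B := by
    intro A B z hz
    rw [hFcoe, mem_iUnion] at hz
    obtain ⟨i, a, ha, rfl⟩ := hz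
    obtain ⟨b, hb, hab⟩ := B.isCompact.exists_infEDist_eq_edist B.nonempty a
    refine ⟨Φ.S i b, mem_iUnion.2 ⟨i, b, hb, rfl⟩, (hS i a b).trans ?_⟩
    gcongr
    rw [← hab]
    exact Metric.infEDist_le_hausdorffEDist_of_mem ha
  have hF : ContractingWith c F := by
    refine ⟨hc, fun A B => ?_⟩
    refine Metric.hausdorffEDist_le_of_mem_edist (key A B) fun z hz => ?_
    obtain ⟨w, hw, h⟩ := key B A z hz
    exact ⟨w, hw, by rwa [Metric.hausdorffEDist_comm] at h⟩
  have : Nonempty (TopologicalSpace.NonemptyCompacts Φ.X) :=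
    ⟨⟨⟨{Classical.arbitrary Φ.X}, isCompact_singleton⟩, singleton_nonempty _⟩⟩
  have hfix := hF.fixedPoint_isFixedPt
  refine ⟨(ContractingWith.fixedPoint F hF : TopologicalSpace.NonemptyCompacts Φ.X),
    ⟨TopologicalSpace.NonemptyCompacts.nonempty _, TopologicalSpace.NonemptyCompacts.isCompact _,
      ?_⟩, ?_⟩
  · conv_lhs => rw [← hfix]
    rfl
  · rintro K ⟨hne, hcp, hK⟩
    have : Function.IsFixedPt F ⟨⟨K, hcp⟩, hne⟩ := by
      apply SetLike.coe_injective
      exact hK.symm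
    rw [← hF.fixedPoint_unique this]
    rfl

/-- The attractor `K` of the IFS. -/
noncomputable def attractor (Φ : IFS d ℓ) : Set Φ.X := Φ.existsUnique_attractor.choose

theorem attractor_spec (Φ : IFS d ℓ) : Φ.attractor.Nonempty ∧ IsCompact Φ.attractor ∧
    Φ.attractor = ⋃ i, Φ.S i '' Φ.attractor :=
  Φ.existsUnique_attractor.choose_spec.1

/-- `Φ.comp x n` is the composition `S_{x_1} ∘ S_{x_2} ∘ ⋯ ∘ S_{x_n}`; the sequence
`x_1, x_2, …` is written `x 0, x 1, …`. -/
def comp (Φ : IFS d ℓ) (x : ℕ → Fin ℓ) : ℕ → Φ.X → Φ.X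
  | 0 => id
  | n + 1 => Φ.comp x n ∘ Φ.S (x n)

/-- The intersection of the sets `S_{x_1} ∘ ⋯ ∘ S_{x_n}(K)`, `n ≥ 1`, is a single point. -/
theorem exists_iInter_comp_eq_singleton (Φ : IFS d ℓ) (x : ℕ → Fin ℓ) :
    ∃ z : Φ.X, ⋂ n : ℕ, Φ.comp x (n + 1) '' Φ.attractor = {z} := by
  obtain ⟨c, hc, hS⟩ := Φ.exists_ratio
  obtain ⟨hne, hcp, hK⟩ := Φ.attractor_spec
  have hlip : ∀ n, LipschitzWith (c ^ n) (Φ.comp x n) := by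
    intro n
    induction n with
    | zero => simpa [comp] using LipschitzWith.id
    | succ n ih => rw [pow_succ]; exact ih.comp (hS (x n))
  have hcpn : ∀ n, IsCompact (Φ.comp x (n + 1) '' Φ.attractor) := fun n =>
    hcp.image (hlip _).continuous
  have hanti : ∀ n, Φ.comp x (n + 1 + 1) '' Φ.attractor ⊆ Φ.comp x (n + 1) '' Φ.attractor := by
    intro n
    change (Φ.comp x (n + 1) ∘ Φ.S (x (n + 1))) '' _ ⊆ _
    rw [image_comp]
    apply image_mono
    conv_rhs => rw [hK]
    exact subset_iUnion (fun i => Φ.S i '' Φ.attractor) _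
  obtain ⟨z, hz⟩ := IsCompact.nonempty_iInter_of_sequence_nonempty_isCompact_isClosed
    (fun n => Φ.comp x (n + 1) '' Φ.attractor) hanti (fun n => hne.image _) (hcpn 0)
    (fun n => (hcpn n).isClosed)
  refine ⟨z, Subset.antisymm (fun w hw => ?_) (singleton_subset_iff.2 hz)⟩
  have hle : ∀ n : ℕ, edist w z ≤ (c : ℝ≥0∞) ^ (n + 1) * Metric.ediam Φ.attractor := by
    intro n
    obtain ⟨a, ha, rfl⟩ := mem_iInter.1 hw n
    obtain ⟨b, hb, hbz⟩ := mem_iInter.1 hz n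
    rw [← hbz]
    refine (hlip (n + 1) a b).trans ?_
    push_cast
    gcongr
    exact Metric.edist_le_ediam_of_mem ha hb
  have htop : Metric.ediam Φ.attractor ≠ ⊤ := hcp.isBounded.ediam_ne_top
  have hlim : Tendsto (fun n : ℕ => (c : ℝ≥0∞) ^ (n + 1) * Metric.ediam Φ.attractor) atTop
      (𝓝 (0 * Metric.ediam Φ.attractor)) := by
    refine ENNReal.Tendsto.mul_const ?_ (Or.inr htop)
    exact (ENNReal.tendsto_pow_atTop_nhds_zero_of_lt_one (by exact_mod_cast hc)).comp
      (tendsto_add_atTop_nat 1)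
  rw [zero_mul] at hlim
  exact edist_le_zero.1 (ge_of_tendsto' hlim hle)

/-- The canonical projection `π : Σ → ℝ^d`,
`{π x} = ⋂ n ≥ 1, S_{x_1} ∘ ⋯ ∘ S_{x_n}(K)`. -/
noncomputable def proj (Φ : IFS d ℓ) (x : ℕ → Fin ℓ) : EuclideanSpace ℝ (Fin d) :=
  ((Φ.exists_iInter_comp_eq_singleton x).choose : Φ.X)

end IFS

/-- The left shift `σ` on `Σ = {1, …, ℓ}^ℕ`. -/
def leftShift {ℓ : ℕ} (x : ℕ → Fin ℓ) : ℕ → Fin ℓ := fun n => x (n + 1)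

/-- The labelling of the partition `𝒫 = {[1], …, [ℓ]}` of `Σ` by first symbols. -/
def firstSymbol {ℓ : ℕ} (x : ℕ → Fin ℓ) : Fin ℓ := x 0

section Entropy

variable {Ω : Type*} {ι : Type*}

/-- A partition is given by a labelling `ξ : Ω → ι`, its members being the sets `ξ ⁻¹' {i}`.
`joinPartition T ξ n` labels the partition `ξ ∨ T⁻¹ξ ∨ ⋯ ∨ T⁻⁽ⁿ⁻¹⁾ξ`. -/
def joinPartition (T : Ω → Ω) (ξ : Ω → ι) (n : ℕ) (x : Ω) : Fin n → ι := fun i => ξ (T^[i] x)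

/-- The member of the partition `ξ` that contains `x`. -/
def partitionCell (ξ : Ω → ι) (x : Ω) : Set Ω := ξ ⁻¹' {ξ x}

/-- The conditional information `I_ν(ξ|𝒜) = - ∑_{A ∈ ξ} χ_A log E_ν(χ_A|𝒜)`. -/
noncomputable def condInfo [Fintype ι] (𝒜 : MeasurableSpace Ω) {mΩ : MeasurableSpace Ω}
    (ν : Measure Ω) (ξ : Ω → ι) (x : Ω) : ℝ :=
  -∑ i, (ξ ⁻¹' {i}).indicator
    (fun y => Real.log ((ν[(ξ ⁻¹' {i}).indicator (fun _ => (1 : ℝ)) | 𝒜]) y)) x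

/-- The conditional entropy `H_ν(ξ|𝒜) = ∫ I_ν(ξ|𝒜) dν`. -/
noncomputable def condEntropy [Fintype ι] (𝒜 : MeasurableSpace Ω) {mΩ : MeasurableSpace Ω}
    (ν : Measure Ω) (ξ : Ω → ι) : ℝ :=
  ∫ x, condInfo 𝒜 ν ξ x ∂ν

/-- The entropy `H_ν(ξ) = - ∑_{A ∈ ξ} ν(A) log ν(A)` of a finite partition. -/
noncomputable def partEntropy [Fintype ι] [MeasurableSpace Ω] (ν : Measure Ω) (ξ : Ω → ι) : ℝ :=
  ∑ i, Real.negMulLog (ν.real (ξ ⁻¹' {i}))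

/-- The measure-theoretic (Kolmogorov-Sinai) entropy `h(T,ν)`: the supremum over the finite
measurable partitions `ξ` of `lim (1/n) H_ν(ξ ∨ T⁻¹ξ ∨ ⋯ ∨ T⁻⁽ⁿ⁻¹⁾ξ)`. -/
noncomputable def measureEntropy [MeasurableSpace Ω] (T : Ω → Ω) (ν : Measure Ω) : EReal :=
  ⨆ (k : ℕ) (ξ : Ω → Fin k) (_ : Measurable ξ),
    limsup (fun n : ℕ => ((partEntropy ν (joinPartition T ξ n) / n : ℝ) : EReal)) atTop

end Entropy

/-- The projection entropy `h_π(σ,m) = H_m(𝒫|σ⁻¹π⁻¹γ) - H_m(𝒫|π⁻¹γ)`, where `γ` is the Borel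
`σ`-algebra of `ℝ^d`. -/
noncomputable def projEntropy {d ℓ : ℕ} (Φ : IFS d ℓ) (m : Measure (ℕ → Fin ℓ)) : ℝ :=
  condEntropy (MeasurableSpace.comap (Φ.proj ∘ leftShift) (borel _)) m firstSymbol -
    condEntropy (MeasurableSpace.comap Φ.proj (borel _)) m firstSymbol

/-- The conditional measures `m_x^η` of `m` for the partition `η = {π⁻¹(z) : z ∈ ℝ^d}`, that is,
the regular conditional probabilities of `m` given `π⁻¹γ`. -/
noncomputable def fibreMeasure {d ℓ : ℕ} (Φ : IFS d ℓ) (m : Measure (ℕ → Fin ℓ))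
    [IsFiniteMeasure m] (x : ℕ → Fin ℓ) : Measure (ℕ → Fin ℓ) :=
  condExpKernel m (MeasurableSpace.comap Φ.proj (borel _)) x

open Classical in
/-- The metric on `Σ`: `dist x y = ℓ⁻ⁿ` for `x ≠ y`, where `n` is the length of the longest common
initial word of `x` and `y`. -/
@[reducible] noncomputable def symbolicMetric (ℓ : ℕ) : MetricSpace (ℕ → Fin ℓ) where
  dist x y := if x = y then 0 else ((ℓ : ℝ)⁻¹) ^ PiNat.firstDiff x y
  dist_self x := by simp
  dist_comm x y := by simp only [eq_comm, PiNat.firstDiff_comm]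
  dist_triangle x y z := by
    have hℓ : 0 < ℓ := (Nat.zero_le _).trans_lt (x 0).2
    have h0 : (0 : ℝ) ≤ (ℓ : ℝ)⁻¹ := by positivity
    have h1 : (ℓ : ℝ)⁻¹ ≤ 1 := inv_le_one_of_one_le₀ (by exact_mod_cast hℓ)
    have hp : ∀ n : ℕ, (0 : ℝ) ≤ (ℓ : ℝ)⁻¹ ^ n := fun n => pow_nonneg h0 n
    by_cases hxz : x = z
    · simp only [hxz, if_true]
      split_ifs <;> positivity
    by_cases hxy : x = y
    · simp [hxy]
    by_cases hyz : y = z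
    · simp [hyz]
    simp only [hxz, hxy, hyz, if_false]
    rcases min_le_iff.1 (PiNat.min_firstDiff_le x y z hxz) with h | h
    · exact (pow_le_pow_of_le_one h0 h1 h).trans (le_add_of_nonneg_right (hp _))
    · exact (pow_le_pow_of_le_one h0 h1 h).trans (le_add_of_nonneg_left (hp _))
  eq_of_dist_eq_zero {x y} h := by
    have hℓ : 0 < ℓ := (Nat.zero_le _).trans_lt (x 0).2
    by_contra hxy
    have hpos : (0 : ℝ) < (ℓ : ℝ)⁻¹ ^ PiNat.firstDiff x y := by positivity
    simp only [hxy, if_false] at h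
    exact hpos.ne' h

/-- The Hausdorff dimension of a subset of `Σ`, with respect to `symbolicMetric`. -/
noncomputable def symbolicDimH {ℓ : ℕ} (A : Set (ℕ → Fin ℓ)) : ℝ≥0∞ :=
  letI := symbolicMetric ℓ
  dimH A

/-- The Hausdorff dimension of a measure on `Σ`: the infimum of the Hausdorff dimensions of the
Borel sets of full measure. -/
noncomputable def measureDimH {ℓ : ℕ} (μ : Measure (ℕ → Fin ℓ)) : ℝ≥0∞ :=
  ⨅ (A : Set (ℕ → Fin ℓ)) (_ : MeasurableSet A) (_ : μ Aᶜ = 0), symbolicDimH A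

/-! Write `I(·|·)` for conditional information. Since each `S_i` is injective, `π x` and `π (σ x)`
determine each other on a cylinder `[i]`, so there the two σ-algebras differ only in how they weigh
`[i]` itself. With the chain rule and invariance of `m` this gives (`condInfo_word_succ`) that the
information of the first `n + 1` symbols given `π` equals `D + I(𝒫 | σ⁻¹(π⁻¹γ ∨ first n symbols))`,
plus the information of the first `n` symbols given `π` evaluated at `σ x`. Here `D = I(𝒫|π⁻¹γ) -
I(𝒫|σ⁻¹π⁻¹γ)` has integral `-h_π`.

Iterating produces sums in which the observable changes with time. It converges, by Lévy's theorem,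
to information given `σ⁻¹` of all Borel sets, and Chung's lemma dominates it. Maker's theorem, a
consequence of Birkhoff's, then shows that `-(1/n) log m_x^η` of the `n`-cylinder of `x` converges
a.e. to `fibreRate`, a conditional expectation given the invariant sets. The integral of the limit
is `H(𝒫 | σ⁻¹ Borel) - h_π`, which is `h - h_π` by the Kolmogorov–Sinai theorem. The limit is
nonnegative, so equality of the entropies means that it vanishes a.e.

For the dimension, `m_x^η` is constant along fibres and carried by the fibre of `x`, so the rate at
almost every point `y` of a fibre is read off from the single measure `m_x^η`. Zero rate makes
cylinders heavy, and covering by them gives dimension `0`; positive rate on a set of positive mass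
makes them light there, and the mass distribution principle forces positive dimension
(`symbolicDimH_le_of_measure_word_ge`, `le_symbolicDimH_of_measure_word_le`). If all fibres have
dimension `0`, so do the measures they carry. -/

/-! ### Pointwise ergodic theorems of Birkhoff and Maker. -/

section Birkhoff

variable {Ω : Type*}

/-- The running maximum `max (0, S_1 φ, …, S_n φ)` of the Birkhoff sums of `φ`. -/
def birkhoffMax (T : Ω → Ω) (φ : Ω → ℝ) : ℕ → Ω → ℝ
  | 0 => 0
  | n + 1 => fun x => max 0 (φ x + birkhoffMax T φ n (T x))

theorem birkhoffMax_nonneg (T : Ω → Ω) (φ : Ω → ℝ) (n : ℕ) (x : Ω) :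
    0 ≤ birkhoffMax T φ n x := by
  cases n with
  | zero => exact le_rfl
  | succ n => exact le_max_left _ _

theorem birkhoffMax_le_succ (T : Ω → Ω) (φ : Ω → ℝ) (n : ℕ) (x : Ω) :
    birkhoffMax T φ n x ≤ birkhoffMax T φ (n + 1) x := by
  induction n generalizing x with
  | zero => exact birkhoffMax_nonneg T φ 1 x
  | succ n ih =>
    change max 0 (φ x + birkhoffMax T φ n (T x)) ≤ max 0 (φ x + birkhoffMax T φ (n + 1) (T x))
    have := ih (T x)
    gcongr

theorem birkhoffMax_monotone (T : Ω → Ω) (φ : Ω → ℝ) (x : Ω) :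
    Monotone fun n => birkhoffMax T φ n x :=
  monotone_nat_of_le_succ fun n => birkhoffMax_le_succ T φ n x

theorem birkhoffSum_le_birkhoffMax (T : Ω → Ω) (φ : Ω → ℝ) (n : ℕ) (x : Ω) :
    birkhoffSum T φ n x ≤ birkhoffMax T φ n x := by
  induction n generalizing x with
  | zero => exact le_rfl
  | succ n ih =>
    rw [birkhoffSum_succ']
    exact (add_le_add_right (ih (T x)) _).trans (le_max_right _ _)

/-- The set of points whose Birkhoff sums have no upper bound. -/
def birkhoffUnbounded (T : Ω → Ω) (φ : Ω → ℝ) : Set Ω :=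
  {x | ∀ C : ℕ, ∃ n, (C : ℝ) < birkhoffMax T φ n x}

/-- Dropping the first term changes the sums by the finite amount `φ x`. Exact invariance of the set
is what allows integrating conditional expectations over it. -/
theorem preimage_birkhoffUnbounded (T : Ω → Ω) (φ : Ω → ℝ) :
    T ⁻¹' birkhoffUnbounded T φ = birkhoffUnbounded T φ := by
  ext x
  constructor
  · intro h C
    obtain ⟨N, hN⟩ := exists_nat_ge (C - φ x)
    obtain ⟨n, hn⟩ := h N
    refine ⟨n + 1, lt_of_lt_of_le ?_ (le_max_right _ _)⟩
    linarith
  · intro h C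
    obtain ⟨N, hN⟩ := exists_nat_ge (C + |φ x|)
    obtain ⟨n, hn⟩ := h N
    cases n with
    | zero =>
      have h0 : birkhoffMax T φ 0 x = 0 := rfl
      rw [h0] at hn
      exact absurd hn (not_lt.2 N.cast_nonneg)
    | succ n =>
      refine ⟨n, ?_⟩
      rcases lt_max_iff.1 hn with h0 | h1
      · exact absurd h0 (not_lt.2 N.cast_nonneg)
      · have := le_abs_self (φ x)
        linarith

variable [MeasurableSpace Ω] {T : Ω → Ω} {μ : Measure Ω}

theorem integrable_birkhoffMax (hT : MeasurePreserving T μ μ) {φ : Ω → ℝ} (hφ : Integrable φ μ)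
    (n : ℕ) : Integrable (birkhoffMax T φ n) μ := by
  induction n with
  | zero => exact integrable_zero _ _ _
  | succ n ih => exact (integrable_zero _ _ _).sup (hφ.add (hT.integrable_comp_of_integrable ih))

theorem measurable_birkhoffMax (hT : Measurable T) {φ : Ω → ℝ} (hφ : Measurable φ) (n : ℕ) :
    Measurable (birkhoffMax T φ n) := by
  induction n with
  | zero => exact measurable_const
  | succ n ih => exact measurable_const.max (hφ.add (ih.comp hT))

theorem measurableSet_birkhoffUnbounded (hT : Measurable T) {φ : Ω → ℝ} (hφ : Measurable φ) :
    MeasurableSet (birkhoffUnbounded T φ) := by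
  have : birkhoffUnbounded T φ = ⋂ C : ℕ, ⋃ n, {x | (C : ℝ) < birkhoffMax T φ n x} := by
    ext x; simp [birkhoffUnbounded]
  rw [this]
  exact MeasurableSet.iInter fun C => MeasurableSet.iUnion fun n =>
    measurableSet_lt measurable_const (measurable_birkhoffMax hT hφ n)

/-- The maximal ergodic theorem on the set where the Birkhoff sums are unbounded. -/
theorem setIntegral_birkhoffUnbounded_nonneg (hT : MeasurePreserving T μ μ) {φ : Ω → ℝ}
    (hφm : Measurable φ) (hφ : Integrable φ μ) : 0 ≤ ∫ x in birkhoffUnbounded T φ, φ x ∂μ := by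
  set A := birkhoffUnbounded T φ with hA
  have hAm : MeasurableSet A := measurableSet_birkhoffUnbounded hT.measurable hφm
  have hTA : MeasurePreserving T (μ.restrict A) (μ.restrict A) := by
    have := hT.restrict_preimage hAm
    rwa [hA, preimage_birkhoffUnbounded] at this
  have hint : ∀ n, Integrable (birkhoffMax T φ n) (μ.restrict A) := fun n =>
    (integrable_birkhoffMax hT hφ n).restrict
  -- On the invariant set the left side tends to `φ`, because the maxima at `T x` tend to infinity.
  -- The right side has nonnegative integral, because `T` preserves the restricted measure and the
  -- maxima increase with `n`.
  have hdiff : ∀ n x, max (-birkhoffMax T φ n (T x)) (φ x) =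
      birkhoffMax T φ (n + 1) x - birkhoffMax T φ n (T x) := by
    intro n x
    change _ = max 0 (φ x + birkhoffMax T φ n (T x)) - _
    rw [max_sub_sub_right 0 (φ x + birkhoffMax T φ n (T x)) (birkhoffMax T φ n (T x)) |>.symm]
    simp
  have hlim : Tendsto (fun n => ∫ x in A, max (-birkhoffMax T φ n (T x)) (φ x) ∂μ) atTop
      (𝓝 (∫ x in A, φ x ∂μ)) := by
    refine tendsto_integral_of_dominated_convergence (fun x => |φ x|) (fun n => ?_)
      hφ.restrict.abs (fun n => ae_of_all _ fun x => ?_) ?_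
    · exact (((measurable_birkhoffMax hT.measurable hφm n).comp hT.measurable).neg.max
        hφm).aestronglyMeasurable
    · have h0 := birkhoffMax_nonneg T φ n (T x)
      rw [Real.norm_eq_abs]
      rcases le_total 0 (φ x) with h | h
      · rw [max_eq_right (by linarith)]
      · rw [abs_of_nonpos (max_le (by linarith) h), abs_of_nonpos h]
        exact neg_le_neg (le_max_right _ _)
    · filter_upwards [ae_restrict_mem hAm] with x hx
      refine tendsto_const_nhds.congr' ?_
      have hx' : T x ∈ A := by
        rw [hA, ← preimage_birkhoffUnbounded] at hx
        exact hx
      obtain ⟨C, hC⟩ := exists_nat_ge (-φ x)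
      obtain ⟨N, hN⟩ := hx' C
      filter_upwards [eventually_ge_atTop N] with n hn
      have := birkhoffMax_monotone T φ (T x) hn
      simp only at this
      rw [max_eq_right (by linarith)]
  refine ge_of_tendsto' hlim fun n => ?_
  simp_rw [hdiff]
  rw [integral_sub (hint _)
    (show Integrable (fun x => birkhoffMax T φ n (T x)) (μ.restrict A) from
      hTA.integrable_comp_of_integrable (hint n))]
  have : ∫ x in A, birkhoffMax T φ n (T x) ∂μ = ∫ x in A, birkhoffMax T φ n x ∂μ := by
    have h1 := hTA.map_eq
    conv_rhs => rw [← h1]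
    rw [integral_map hTA.measurable.aemeasurable (by rw [h1]; exact (hint n).1)]
  rw [this, sub_nonneg]
  exact integral_mono (hint n) (hint _) fun x => birkhoffMax_le_succ T φ n x

/-- The function `f - E(f|invariants) - ε/2` has integral `-(ε/2) μ(A)` over the invariant set `A`
where its sums are unbounded. The maximal theorem makes this nonnegative, so `A` is null. Off `A`
the bound on the sums disappears after division by `n`, within the remaining `ε/2`. -/
theorem ae_eventually_birkhoffAverage_lt [IsProbabilityMeasure μ] (hT : MeasurePreserving T μ μ)
    {f : Ω → ℝ} (hfm : Measurable f) (hf : Integrable f μ) {ε : ℝ} (hε : 0 < ε) :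
    ∀ᵐ x ∂μ, ∀ᶠ n in atTop,
      birkhoffAverage ℝ T f n x < (μ[f | MeasurableSpace.invariants T]) x + ε := by
  set e := μ[f | MeasurableSpace.invariants T] with he
  have hle := MeasurableSpace.invariants_le T
  have hem' : Measurable[MeasurableSpace.invariants T] e := stronglyMeasurable_condExp.measurable
  have hem : Measurable e := hem'.mono hle le_rfl
  have heT : e ∘ T = e := MeasurableSpace.comp_eq_of_measurable_invariants hem'
  set φ : Ω → ℝ := fun x => f x - e x - ε / 2 with hφdef
  have hφm : Measurable φ := (hfm.sub hem).sub_const _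
  have hφ : Integrable φ μ := (hf.sub integrable_condExp).sub (integrable_const _)
  set A := birkhoffUnbounded T φ with hA
  have hAm : MeasurableSet A := measurableSet_birkhoffUnbounded hT.measurable hφm
  have hAi : MeasurableSet[MeasurableSpace.invariants T] A :=
    MeasurableSpace.measurableSet_invariants.2 ⟨hAm, preimage_birkhoffUnbounded T φ⟩
  have h0 := setIntegral_birkhoffUnbounded_nonneg hT hφm hφ
  have h1 : ∫ x in A, φ x ∂μ = -(ε / 2) * μ.real A := by
    have h2 : Integrable e (μ.restrict A) := integrable_condExp.restrict
    have h3 : ∫ x in A, e x ∂μ = ∫ x in A, f x ∂μ := setIntegral_condExp hle hf hAi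
    simp only [hφdef]
    rw [integral_sub (f := fun x => f x - e x) (hf.restrict.sub h2) (integrable_const _),
      integral_sub hf.restrict h2, h3]
    simp [mul_comm]
  have hA0 : μ A = 0 := by
    rw [h1] at h0
    have h2 : μ.real A = 0 := by
      have := measureReal_nonneg (μ := μ) (s := A)
      nlinarith
    rwa [measureReal_eq_zero_iff] at h2
  filter_upwards [compl_mem_ae_iff.2 hA0] with x hx
  have hx' : ∃ C : ℕ, ∀ n, birkhoffMax T φ n x ≤ C := by
    by_contra! h
    exact hx fun C => h C
  obtain ⟨C, hC⟩ := hx'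
  have hsum : ∀ n, birkhoffSum T f n x ≤ C + n * (e x + ε / 2) := by
    intro n
    have h2 := (birkhoffSum_le_birkhoffMax T φ n x).trans (hC n)
    have h3 : birkhoffSum T φ n x = birkhoffSum T f n x - n * (e x + ε / 2) := by
      have hit : ∀ k, e (T^[k] x) = e x := by
        intro k
        induction k generalizing x with
        | zero => rfl
        | succ k ih =>
          rw [Function.iterate_succ_apply']
          exact (congrFun heT _).trans (by
            clear ih
            induction k with
            | zero => rfl
            | succ k ih2 =>
              rw [Function.iterate_succ_apply']; exact (congrFun heT _).trans ih2)
      simp only [birkhoffSum, hφdef, hit, Finset.sum_sub_distrib, Finset.sum_const,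
        Finset.card_range, nsmul_eq_mul]
      ring
    linarith
  obtain ⟨N, hN⟩ := exists_nat_gt (C / (ε / 2))
  filter_upwards [eventually_ge_atTop (N + 1)] with n hn
  have hn0 : (0 : ℝ) < n := by exact_mod_cast (by omega : 0 < n)
  have hNn : (N : ℝ) ≤ n := by exact_mod_cast (by omega : N ≤ n)
  rw [birkhoffAverage, smul_eq_mul, inv_mul_lt_iff₀ hn0]
  rw [div_lt_iff₀ (by positivity)] at hN
  have := hsum n
  nlinarith

theorem tendsto_birkhoffAverage_of_measurable [IsProbabilityMeasure μ]
    (hT : MeasurePreserving T μ μ) {f : Ω → ℝ} (hfm : Measurable f) (hf : Integrable f μ) :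
    ∀ᵐ x ∂μ, Tendsto (fun n => birkhoffAverage ℝ T f n x) atTop
      (𝓝 ((μ[f | MeasurableSpace.invariants T]) x)) := by
  have h1 : ∀ᵐ x ∂μ, ∀ k : ℕ, ∀ᶠ n in atTop, birkhoffAverage ℝ T f n x <
      (μ[f | MeasurableSpace.invariants T]) x + 1 / ((k : ℝ) + 1) :=
    ae_all_iff.2 fun k => ae_eventually_birkhoffAverage_lt hT hfm hf (by positivity)
  have h2 : ∀ᵐ x ∂μ, ∀ k : ℕ, ∀ᶠ n in atTop, birkhoffAverage ℝ T (-f) n x <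
      (μ[-f | MeasurableSpace.invariants T]) x + 1 / ((k : ℝ) + 1) :=
    ae_all_iff.2 fun k => ae_eventually_birkhoffAverage_lt hT hfm.neg hf.neg (by positivity)
  filter_upwards [h1, h2, condExp_neg (μ := μ) f (MeasurableSpace.invariants T)] with x hx1 hx2 hx3
  rw [Metric.tendsto_atTop']
  intro ε hε
  obtain ⟨k, hk⟩ := exists_nat_one_div_lt hε
  obtain ⟨N, hN⟩ := eventually_atTop.1 ((hx1 k).and (hx2 k))
  refine ⟨N, fun n hn => ?_⟩
  obtain ⟨ha, hb⟩ := hN n hn.le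
  have hneg : birkhoffAverage ℝ T (-f) n x = -birkhoffAverage ℝ T f n x := by
    simp [birkhoffAverage, birkhoffSum]
  rw [hx3, hneg, Pi.neg_apply] at hb
  rw [Real.dist_eq, abs_lt]
  constructor <;> linarith

/-- **Birkhoff's pointwise ergodic theorem.** -/
theorem tendsto_birkhoffAverage [IsProbabilityMeasure μ]
    (hT : MeasurePreserving T μ μ) {f : Ω → ℝ} (hf : Integrable f μ) :
    ∀ᵐ x ∂μ, Tendsto (fun n => birkhoffAverage ℝ T f n x) atTop
      (𝓝 ((μ[f | MeasurableSpace.invariants T]) x)) := by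
  obtain ⟨g, hgm, hfg⟩ := hf.1
  have h1 := tendsto_birkhoffAverage_of_measurable hT hgm.measurable (hf.congr hfg)
  have h2 : ∀ᵐ x ∂μ, ∀ n, birkhoffAverage ℝ T f n x = birkhoffAverage ℝ T g n x :=
    ae_all_iff.2 fun n => hT.quasiMeasurePreserving.birkhoffAverage_ae_eq_of_ae_eq ℝ hfg n
  filter_upwards [h1, h2, condExp_congr_ae (m := MeasurableSpace.invariants T) hfg]
    with x hx1 hx2 hx3
  simpa only [hx2, hx3] using hx1

/-- Averages along an antidiagonal, with errors controlled by decreasing averages. -/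
theorem tendsto_antidiagonal_average {u : ℕ → ℕ → ℝ} {a : ℕ → ℝ} {b : ℕ → ℕ → ℝ} {e : ℝ}
    {c : ℕ → ℝ} (hb : ∀ N j, 0 ≤ b N j) (hu : ∀ N k j, N ≤ k → |u k j - a j| ≤ b N j)
    (ha : Tendsto (fun n : ℕ => (n : ℝ)⁻¹ * ∑ j ∈ Finset.range n, a j) atTop (𝓝 e))
    (hbc : ∀ N, Tendsto (fun n : ℕ => (n : ℝ)⁻¹ * ∑ j ∈ Finset.range n, b N j) atTop (𝓝 (c N)))
    (hc : ∀ ε > 0, ∃ N, c N < ε) :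
    Tendsto (fun n : ℕ => (n : ℝ)⁻¹ * ∑ j ∈ Finset.range n, u (n - 1 - j) j) atTop (𝓝 e) := by
  have hmain : Tendsto (fun n : ℕ => (n : ℝ)⁻¹ * ∑ j ∈ Finset.range n, (u (n - 1 - j) j - a j))
      atTop (𝓝 0) := by
    rw [Metric.tendsto_atTop']
    intro ε hε
    obtain ⟨N, hN⟩ := hc ε hε
    -- The indices `j < n - N` are controlled by `b N`. The last `N` only have the bound `b 0`, but
    -- their sum is the difference of two sums whose averages have the same limit.
    have hshift : Tendsto (fun n : ℕ => (n : ℝ)⁻¹ * ∑ j ∈ Finset.range (n - N), b 0 j) atTop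
        (𝓝 (c 0)) := by
      have h1 := (hbc 0).comp (tendsto_sub_atTop_nat N)
      have h2 : Tendsto (fun n : ℕ => ((n - N : ℕ) : ℝ) * (n : ℝ)⁻¹) atTop (𝓝 1) := by
        have h3 : Tendsto (fun n : ℕ => 1 - (N : ℝ) * (n : ℝ)⁻¹) atTop (𝓝 (1 - N * 0)) :=
          tendsto_const_nhds.sub (tendsto_const_nhds.mul tendsto_inv_atTop_nhds_zero_nat)
        rw [mul_zero, sub_zero] at h3
        refine h3.congr' ?_
        filter_upwards [eventually_ge_atTop (N + 1)] with n hn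
        have : (n : ℝ) ≠ 0 := by exact_mod_cast (by omega : n ≠ 0)
        rw [Nat.cast_sub (by omega)]
        field_simp
      have h3 := h2.mul h1
      rw [one_mul] at h3
      refine h3.congr' ?_
      filter_upwards [eventually_ge_atTop (N + 1)] with n hn
      have : ((n - N : ℕ) : ℝ) ≠ 0 := by exact_mod_cast (by omega : n - N ≠ 0)
      simp only [Function.comp]
      field_simp
    have hB := (hbc N).add ((hbc 0).sub hshift)
    rw [sub_self, add_zero] at hB
    obtain ⟨M, hM⟩ := eventually_atTop.1 (hB.eventually_lt_const hN)
    refine ⟨max M N, fun n hn => ?_⟩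
    have hMn := hM n ((le_max_left _ _).trans hn.le)
    have hNn : N ≤ n := (le_max_right _ _).trans hn.le
    rw [dist_zero_right, Real.norm_eq_abs, abs_mul, abs_of_nonneg (by positivity)]
    refine lt_of_le_of_lt ?_ hMn
    rw [← mul_sub, ← mul_add]
    refine mul_le_mul_of_nonneg_left ?_ (by positivity)
    refine (Finset.abs_sum_le_sum_abs _ _).trans ?_
    have hsplit : ∑ j ∈ Finset.range n, b 0 j - ∑ j ∈ Finset.range (n - N), b 0 j =
        ∑ j ∈ Finset.range n, if n - N ≤ j then b 0 j else 0 := by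
      rw [← Finset.sum_filter, sub_eq_iff_eq_add,
        ← Finset.sum_filter_add_sum_filter_not (Finset.range n) (fun j => n - N ≤ j)]
      congr 1
      refine Finset.sum_congr ?_ fun _ _ => rfl
      ext j
      simp only [Finset.mem_filter, Finset.mem_range]
      omega
    rw [hsplit, ← Finset.sum_add_distrib]
    refine Finset.sum_le_sum fun j hj => ?_
    have hj' := Finset.mem_range.1 hj
    split_ifs with h
    · exact (hu 0 _ _ (Nat.zero_le _)).trans (le_add_of_nonneg_left (hb _ _))
    · rw [add_zero]
      exact hu N _ _ (by omega)
  have := hmain.add ha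
  rw [zero_add] at this
  refine this.congr fun n => ?_
  rw [← mul_add, ← Finset.sum_add_distrib]
  simp

/-- **Maker's ergodic theorem**: a Birkhoff theorem for a dominated convergent sequence of
observables. -/
theorem tendsto_average_of_dominated [IsProbabilityMeasure μ] (hT : MeasurePreserving T μ μ)
    {g : ℕ → Ω → ℝ} {g' G : Ω → ℝ} (hgm : ∀ n, Measurable (g n)) (hg'm : Measurable g')
    (hG : Integrable G μ) (hgG : ∀ᵐ x ∂μ, ∀ n, |g n x| ≤ G x)
    (hg : ∀ᵐ x ∂μ, Tendsto (fun n => g n x) atTop (𝓝 (g' x))) :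
    ∀ᵐ x ∂μ, Tendsto (fun n : ℕ => (n : ℝ)⁻¹ * ∑ j ∈ Finset.range n, g (n - 1 - j) (T^[j] x))
      atTop (𝓝 ((μ[g' | MeasurableSpace.invariants T]) x)) := by
  have hg'G : ∀ᵐ x ∂μ, |g' x| ≤ G x := by
    filter_upwards [hgG, hg] with x h1 h2
    exact le_of_tendsto' h2.abs h1
  have hg'i : Integrable g' μ := hG.mono' hg'm.aestronglyMeasurable hg'G
  -- The tail supremum of the errors, taken in `ℝ≥0∞` so that it exists before boundedness is known.
  set H : ℕ → Ω → ℝ≥0∞ := fun N x => ⨆ k, ENNReal.ofReal |g (N + k) x - g' x| with hH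
  have hHm : ∀ N, Measurable (H N) := fun N =>
    Measurable.iSup fun k => (measurable_norm.comp ((hgm (N + k)).sub hg'm)).ennreal_ofReal
  have hHG : ∀ᵐ x ∂μ, ∀ N, H N x ≤ ENNReal.ofReal (2 * G x) := by
    filter_upwards [hgG, hg'G] with x h1 h2 N
    refine iSup_le fun k => ENNReal.ofReal_le_ofReal ?_
    exact (abs_sub _ _).trans (by linarith [h1 (N + k)])
  have hHtop : ∀ᵐ x ∂μ, ∀ N, H N x ≠ ⊤ := by
    filter_upwards [hHG] with x h N
    exact ne_top_of_le_ne_top ENNReal.ofReal_ne_top (h N)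
  set B : ℕ → Ω → ℝ := fun N x => (H N x).toReal with hB
  have hBbound : ∀ᵐ x ∂μ, ∀ N, ‖B N x‖ ≤ 2 * G x := by
    filter_upwards [hHG, hg'G] with x h h2 N
    have h0 : 0 ≤ G x := (abs_nonneg _).trans h2
    rw [Real.norm_eq_abs, abs_of_nonneg ENNReal.toReal_nonneg]
    exact ENNReal.toReal_le_of_le_ofReal (by linarith) (h N)
  have hBi : ∀ N, Integrable (B N) μ := fun N =>
    (hG.const_mul 2).mono' (hHm N).ennreal_toReal.aestronglyMeasurable
      (hBbound.mono fun x h => h N)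
  have hBle : ∀ᵐ x ∂μ, ∀ N k, N ≤ k → |g k x - g' x| ≤ B N x := by
    filter_upwards [hHtop] with x h N k hk
    obtain ⟨i, rfl⟩ := Nat.exists_eq_add_of_le hk
    rw [hB, ← ENNReal.ofReal_le_iff_le_toReal (h N)]
    exact le_iSup (fun k => ENNReal.ofReal |g (N + k) x - g' x|) i
  have hBlim : ∀ᵐ x ∂μ, Tendsto (fun N => B N x) atTop (𝓝 0) := by
    filter_upwards [hg] with x h
    rw [Metric.tendsto_atTop']
    intro ε hε
    obtain ⟨N, hN⟩ := Metric.tendsto_atTop.1 h (ε / 2) (by positivity)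
    refine ⟨N, fun n hn => ?_⟩
    rw [dist_zero_right, Real.norm_eq_abs, abs_of_nonneg ENNReal.toReal_nonneg]
    refine lt_of_le_of_lt (ENNReal.toReal_le_of_le_ofReal (by positivity) (iSup_le fun k => ?_))
      (half_lt_self hε)
    exact ENNReal.ofReal_le_ofReal (hN (n + k) (by omega)).le
  have hBint : Tendsto (fun N => ∫ x, B N x ∂μ) atTop (𝓝 0) := by
    have := tendsto_integral_of_dominated_convergence (μ := μ) (F := B) (f := fun _ => (0 : ℝ))
      (fun x => 2 * G x) (fun N => (hBi N).1) (hG.const_mul 2)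
      (fun N => hBbound.mono fun x h => h N) hBlim
    simpa using this
  set e : ℕ → Ω → ℝ := fun N => μ[B N | MeasurableSpace.invariants T] with he
  have hem : ∀ N, Measurable (e N) := fun N =>
    (stronglyMeasurable_condExp.measurable).mono (MeasurableSpace.invariants_le T) le_rfl
  have he0 : ∀ᵐ x ∂μ, ∀ N, 0 ≤ e N x :=
    ae_all_iff.2 fun N => condExp_nonneg (ae_of_all _ fun x => ENNReal.toReal_nonneg)
  -- The conditional expectations have the integrals of `B N`, which tend to zero, so their infimum
  -- has integral zero.
  have hinf : ∀ᵐ x ∂μ, ⨅ N, ENNReal.ofReal (e N x) = 0 := by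
    have hm : Measurable fun x => ⨅ N, ENNReal.ofReal (e N x) :=
      Measurable.iInf fun N => (hem N).ennreal_ofReal
    refine (lintegral_eq_zero_iff hm).1 (le_antisymm ?_ bot_le)
    have h1 : Tendsto (fun N => ENNReal.ofReal (∫ x, B N x ∂μ)) atTop (𝓝 0) := by
      simpa using ENNReal.tendsto_ofReal hBint
    refine ge_of_tendsto' h1 fun N => ?_
    rw [← integral_condExp (MeasurableSpace.invariants_le T) (f := B N),
      ofReal_integral_eq_lintegral_ofReal integrable_condExp (he0.mono fun x h => h N)]
    exact lintegral_mono fun x => iInf_le _ N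
  have hBA : ∀ᵐ x ∂μ, ∀ N, Tendsto (fun n => birkhoffAverage ℝ T (B N) n x) atTop (𝓝 (e N x)) :=
    ae_all_iff.2 fun N => tendsto_birkhoffAverage hT (hBi N)
  have hBleT : ∀ᵐ x ∂μ, ∀ j N k, N ≤ k → |g k (T^[j] x) - g' (T^[j] x)| ≤ B N (T^[j] x) :=
    ae_all_iff.2 fun j => (hT.iterate j).quasiMeasurePreserving.ae hBle
  filter_upwards [tendsto_birkhoffAverage hT hg'i, hBA, hBleT, hinf] with x hx1 hx2 hx3 hx4
  refine tendsto_antidiagonal_average (u := fun k j => g k (T^[j] x))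
    (b := fun N j => B N (T^[j] x)) (fun N j => ENNReal.toReal_nonneg)
    (fun N k j h => hx3 j N k h) hx1 hx2 fun ε hε => ?_
  have : ⨅ N, ENNReal.ofReal (e N x) < ENNReal.ofReal ε := by
    rw [hx4]; exact ENNReal.ofReal_pos.2 hε
  obtain ⟨N, hN⟩ := iInf_lt_iff.1 this
  exact ⟨N, (ENNReal.ofReal_lt_ofReal_iff hε).1 hN⟩

end Birkhoff

/-! ### Conditional probabilities under change of the conditioning map. -/

section CondProb

variable {Ω : Type*} {𝒜 : MeasurableSpace Ω} {mΩ : MeasurableSpace Ω} {μ : Measure Ω}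

theorem condProb_nonneg (B : Set Ω) : ∀ᵐ x ∂μ, 0 ≤ (μ⟦B|𝒜⟧) x :=
  condExp_nonneg (ae_of_all _ fun x => indicator_nonneg (fun _ _ => zero_le_one) x)

theorem condProb_mono [IsFiniteMeasure μ] {B C : Set Ω}
    (hB : MeasurableSet B) (hC : MeasurableSet C) (h : B ⊆ C) :
    ∀ᵐ x ∂μ, (μ⟦B|𝒜⟧) x ≤ (μ⟦C|𝒜⟧) x :=
  condExp_mono ((integrable_const _).indicator hB) ((integrable_const _).indicator hC)
    (ae_of_all _ fun x => indicator_le_indicator_of_subset h (fun _ => zero_le_one) x)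

theorem condProb_le_one [IsFiniteMeasure μ] (h𝒜 : 𝒜 ≤ mΩ) {B : Set Ω}
    (hB : MeasurableSet B) : ∀ᵐ x ∂μ, (μ⟦B|𝒜⟧) x ≤ 1 := by
  have h := condProb_mono (μ := μ) (𝒜 := 𝒜) hB MeasurableSet.univ (subset_univ B)
  rw [indicator_univ, condExp_const h𝒜] at h
  exact h

theorem setIntegral_condProb [IsFiniteMeasure μ] (h𝒜 : 𝒜 ≤ mΩ)
    {A B : Set Ω} (hA : MeasurableSet[𝒜] A) (hB : MeasurableSet B) :
    ∫ x in A, (μ⟦B|𝒜⟧) x ∂μ = μ.real (A ∩ B) := by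
  rw [setIntegral_condExp h𝒜 ((integrable_const _).indicator hB) hA, integral_indicator hB]
  simp [measureReal_restrict_apply hB, inter_comm]

/-- The set where the conditional probability is nonpositive is `𝒜`-measurable, so integrating over
it computes the mass of its intersection with `B`. -/
theorem condProb_pos [IsFiniteMeasure μ] (h𝒜 : 𝒜 ≤ mΩ) {B : Set Ω}
    (hB : MeasurableSet B) : ∀ᵐ x ∂μ, x ∈ B → 0 < (μ⟦B|𝒜⟧) x := by
  set N : Set Ω := {x | (μ⟦B|𝒜⟧) x ≤ 0}
  have hN : MeasurableSet[𝒜] N :=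
    (stronglyMeasurable_condExp.measurable : Measurable[𝒜] (μ⟦B|𝒜⟧)) measurableSet_Iic
  have h1 : μ.real (N ∩ B) ≤ 0 := by
    rw [← setIntegral_condProb h𝒜 hN hB]
    exact setIntegral_nonpos (h𝒜 _ hN) fun x hx => hx
  have h2 : μ (N ∩ B) = 0 := by
    rw [← measureReal_eq_zero_iff]
    exact le_antisymm h1 measureReal_nonneg
  filter_upwards [compl_mem_ae_iff.2 h2] with x hx hxB
  by_contra h
  exact hx ⟨not_lt.1 h, hxB⟩

/-- Conditional probability for the measure restricted to `P`, by Bayes' formula. -/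
theorem condProb_restrict [IsFiniteMeasure μ] (h𝒜 : 𝒜 ≤ mΩ)
    {P B : Set Ω} (hP : MeasurableSet P) (hB : MeasurableSet B) :
    (fun x => (μ⟦P ∩ B|𝒜⟧) x / (μ⟦P|𝒜⟧) x) =ᵐ[μ.restrict P] (μ.restrict P)⟦B|𝒜⟧ := by
  set u := μ⟦P ∩ B|𝒜⟧ with hu
  set v := μ⟦P|𝒜⟧ with hv
  have hum : StronglyMeasurable[𝒜] u := stronglyMeasurable_condExp
  have hvm : StronglyMeasurable[𝒜] v := stronglyMeasurable_condExp
  have hqm : StronglyMeasurable[𝒜] fun x => u x / v x := hum.div hvm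
  have hu0 : ∀ᵐ x ∂μ, 0 ≤ u x := condProb_nonneg _
  have huv : ∀ᵐ x ∂μ, u x ≤ v x := condProb_mono (hP.inter hB) hP inter_subset_left
  have hq1 : ∀ᵐ x ∂μ, ‖u x / v x‖ ≤ 1 := by
    filter_upwards [hu0, huv] with x h0 h1
    rw [Real.norm_eq_abs, abs_of_nonneg (div_nonneg h0 (h0.trans h1))]
    exact div_le_one_of_le₀ h1 (h0.trans h1)
  have hqi : Integrable (fun x => u x / v x) μ :=
    (integrable_const (1 : ℝ)).mono' (hqm.mono h𝒜).aestronglyMeasurable hq1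
  refine ae_eq_condExp_of_forall_setIntegral_eq h𝒜 ((integrable_const _).indicator hB)
    (fun s _ _ => hqi.restrict.restrict) (fun s hs _ => ?_) hqm.aestronglyMeasurable
  have hqP : Integrable ((fun x => u x / v x) * P.indicator fun _ => (1 : ℝ)) μ := by
    refine (hqi.indicator hP).congr (ae_of_all _ fun x => ?_)
    by_cases hx : x ∈ P <;> simp [hx]
  have hpull := condExp_mul_of_stronglyMeasurable_left hqm hqP
    ((integrable_const (1 : ℝ)).indicator hP)
  calc ∫ x in s, u x / v x ∂μ.restrict P
      = ∫ x in s, ((fun x => u x / v x) * P.indicator fun _ => (1 : ℝ)) x ∂μ := by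
        rw [Measure.restrict_restrict (h𝒜 _ hs), ← setIntegral_indicator hP]
        refine integral_congr_ae (ae_of_all _ fun x => ?_)
        by_cases hx : x ∈ P <;> simp [hx]
    _ = ∫ x in s, (μ[(fun x => u x / v x) * P.indicator fun _ => (1 : ℝ) | 𝒜]) x ∂μ :=
        (setIntegral_condExp h𝒜 hqP hs).symm
    _ = ∫ x in s, u x ∂μ := by
        refine integral_congr_ae (ae_restrict_of_ae ?_)
        filter_upwards [hpull, hu0, huv] with x hx h0 h1
        rw [hx]
        change u x / v x * v x = u x
        -- Where `v` vanishes the quotient takes its default value `0`, which is correct since `0 ≤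
        -- u ≤ v`.
        rcases eq_or_ne (v x) 0 with h | h
        · rw [h, mul_zero]; linarith
        · field_simp
    _ = μ.real (s ∩ (P ∩ B)) := setIntegral_condProb h𝒜 hs (hP.inter hB)
    _ = ∫ x in s, B.indicator (fun _ => (1 : ℝ)) x ∂μ.restrict P := by
        rw [integral_indicator hB, Measure.restrict_restrict hB,
          Measure.restrict_restrict (hB.inter (h𝒜 _ hs))]
        simp only [integral_const, smul_eq_mul, mul_one, measureReal_restrict_apply_univ]
        congr 1
        ext x; simp only [mem_inter_iff]; tauto

variable {α β : Type*} [mα : MeasurableSpace α] [mβ : MeasurableSpace β]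

/-- Maps that are a.e. measurable functions of each other generate the same σ-algebra up to null
sets. -/
theorem condExp_comap_congr_of_ae [IsFiniteMeasure μ] {f : Ω → α} {f' : Ω → β}
    (hf : Measurable f) (hf' : Measurable f') {R : β → α} {T : α → β} (hR : Measurable R)
    (hT : Measurable T) (hfR : ∀ᵐ x ∂μ, f x = R (f' x)) (hfT : ∀ᵐ x ∂μ, f' x = T (f x))
    {g : Ω → ℝ} (hg : Integrable g μ) :
    μ[g | mβ.comap f'] =ᵐ[μ] μ[g | mα.comap f] := by
  have hm : StronglyMeasurable[mβ.comap f'] (μ[g | mβ.comap f']) := stronglyMeasurable_condExp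
  obtain ⟨φ, hφ, hφe⟩ := hm.measurable.exists_eq_measurable_comp
  have hset : ∀ S : Set α, f ⁻¹' S =ᵐ[μ] f' ⁻¹' (R ⁻¹' S) := by
    intro S
    filter_upwards [hfR] with x hx
    simp only [eq_iff_iff]
    change f x ∈ S ↔ R (f' x) ∈ S
    rw [hx]
  refine ae_eq_condExp_of_forall_setIntegral_eq hf.comap_le hg
    (fun s _ _ => integrable_condExp.integrableOn) ?_ ?_
  · rintro _ ⟨S, hS, rfl⟩ -
    rw [setIntegral_congr_set (hset S), setIntegral_congr_set (hset S),
      setIntegral_condExp hf'.comap_le hg ⟨_, hR hS, rfl⟩]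
  · refine ⟨φ ∘ T ∘ f, ?_, ?_⟩
    · exact ((hφ.comp hT).comp (comap_measurable f)).stronglyMeasurable
    · filter_upwards [hfT] with x hx
      rw [hφe]
      simp [hx]

/-- If `f` and `f'` determine each other on `P`, then the conditional probabilities given `f` and
`f'`, normalized on `P`, agree. -/
theorem condProb_comap_mul_eq [IsFiniteMeasure μ] {f : Ω → α} {f' : Ω → β}
    (hf : Measurable f) (hf' : Measurable f') {R : β → α} {T : α → β} (hR : Measurable R)
    (hT : Measurable T) {P B : Set Ω} (hP : MeasurableSet P) (hB : MeasurableSet B)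
    (hfR : ∀ x ∈ P, f x = R (f' x)) (hfT : ∀ x ∈ P, f' x = T (f x)) :
    ∀ᵐ x ∂μ, x ∈ P → (μ⟦P ∩ B|mα.comap f⟧) x * (μ⟦P|mβ.comap f'⟧) x =
      (μ⟦P ∩ B|mβ.comap f'⟧) x * (μ⟦P|mα.comap f⟧) x := by
  have h1 := condProb_restrict (μ := μ) hf.comap_le hP hB
  have h2 := condProb_restrict (μ := μ) hf'.comap_le hP hB
  -- Under the measure restricted to `P` the two maps determine each other, so the two Bayes
  -- quotients agree.
  have h3 := condExp_comap_congr_of_ae (μ := μ.restrict P) hf hf' hR hT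
    ((ae_restrict_iff' hP).2 (ae_of_all _ hfR)) ((ae_restrict_iff' hP).2 (ae_of_all _ hfT))
    ((integrable_const (1 : ℝ)).indicator hB)
  rw [← ae_restrict_iff' hP]
  have hp1 := (ae_restrict_iff' hP).2 (condProb_pos (μ := μ) hf.comap_le hP)
  have hp2 := (ae_restrict_iff' hP).2 (condProb_pos (μ := μ) hf'.comap_le hP)
  filter_upwards [h1, h2, h3, hp1, hp2] with x h1 h2 h3 hp1 hp2
  rw [h3, ← h1, div_eq_div_iff hp2.ne' hp1.ne'] at h2
  exact h2.symm

/-- On the cell `η = c` the pair `(f, η)` is `(f, c)`, so it carries the same information as `f`.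
The cell is itself measurable for the pair, hence has conditional probability `1` there. -/
theorem condProb_comap_prod_mul {κ : Type*} [mκ : MeasurableSpace κ] [MeasurableSingletonClass κ]
    [IsFiniteMeasure μ] {f : Ω → α} (hf : Measurable f) {η : Ω → κ} (hη : Measurable η)
    {B : Set Ω} (hB : MeasurableSet B) (c : κ) :
    ∀ᵐ x ∂μ, x ∈ η ⁻¹' {c} → (μ⟦η ⁻¹' {c} ∩ B|mα.comap f⟧) x =
      (μ⟦B|MeasurableSpace.comap (fun y => (f y, η y)) Prod.instMeasurableSpace⟧) x *
        (μ⟦η ⁻¹' {c}|mα.comap f⟧) x := by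
  have hC : MeasurableSet (η ⁻¹' {c}) := hη (measurableSet_singleton c)
  have hf' : Measurable fun y => (f y, η y) := hf.prodMk hη
  have hC' : MeasurableSet[MeasurableSpace.comap (fun y => (f y, η y)) Prod.instMeasurableSpace]
      (η ⁻¹' {c}) := ⟨Prod.snd ⁻¹' {c}, measurable_snd (measurableSet_singleton c), rfl⟩
  have h1 := condProb_comap_mul_eq (μ := μ) hf hf' (R := Prod.fst) (T := fun a => (a, c))
    measurable_fst (measurable_id.prodMk measurable_const) hC hB (fun x _ => rfl)
    (fun x hx => by simpa using hx)
  have h2 := condExp_indicator (μ := μ) ((integrable_const (1 : ℝ)).indicator hB) hC'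
  rw [indicator_indicator] at h2
  have h3 : (μ⟦η ⁻¹' {c}|MeasurableSpace.comap (fun y => (f y, η y)) Prod.instMeasurableSpace⟧) =
      (η ⁻¹' {c}).indicator fun _ => (1 : ℝ) :=
    condExp_of_stronglyMeasurable hf'.comap_le
      ((stronglyMeasurable_const).indicator hC') ((integrable_const (1 : ℝ)).indicator hC)
  filter_upwards [h1, h2] with x h1 h2 hx
  have := h1 hx
  rwa [h3, h2, indicator_of_mem hx, indicator_of_mem hx, mul_one] at this

theorem condProb_comap_comp [IsFiniteMeasure μ] {T : Ω → Ω} (hT : MeasurePreserving T μ μ)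
    {f : Ω → α} (hf : Measurable f) {B : Set Ω} (hB : MeasurableSet B) :
    ∀ᵐ x ∂μ, (μ⟦T ⁻¹' B|mα.comap (f ∘ T)⟧) x = (μ⟦B|mα.comap f⟧) (T x) := by
  have hm : StronglyMeasurable[mα.comap f] (μ⟦B|mα.comap f⟧) := stronglyMeasurable_condExp
  have hle := hf.comap_le
  have key : (fun x => (μ⟦B|mα.comap f⟧) (T x)) =ᵐ[μ] μ⟦T ⁻¹' B|mα.comap (f ∘ T)⟧ := by
    refine ae_eq_condExp_of_forall_setIntegral_eq (hf.comp hT.measurable).comap_le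
      ((integrable_const _).indicator (hT.measurable hB))
      (fun s _ _ => (hT.integrable_comp_of_integrable integrable_condExp).integrableOn) ?_ ?_
    · rintro _ ⟨S, hS, rfl⟩ -
      have h1 : MeasurableSet (f ⁻¹' S) := hf hS
      have h2 := setIntegral_map (μ := μ) (f := μ⟦B|mα.comap f⟧) h1
        (by rw [hT.map_eq]; exact (hm.mono hle).aestronglyMeasurable) hT.measurable.aemeasurable
      rw [hT.map_eq] at h2
      rw [preimage_comp, ← h2, setIntegral_condProb hle ⟨S, hS, rfl⟩ hB,
        integral_indicator (hT.measurable hB), Measure.restrict_restrict (hT.measurable hB)]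
      simp only [integral_const, smul_eq_mul, mul_one, measureReal_restrict_apply_univ]
      rw [← preimage_inter, inter_comm, measureReal_def, measureReal_def,
        hT.measure_preimage (hB.inter h1).nullMeasurableSet]
    · refine StronglyMeasurable.aestronglyMeasurable ?_
      rw [← MeasurableSpace.comap_comp]
      exact hm.comp_measurable (comap_measurable T)
  exact key.symm

end CondProb

theorem prodMk_preimage_singleton {Ω ι κ : Type*} (ξ : Ω → ι) (η : Ω → κ) (p : ι × κ) :
    (fun y => (ξ y, η y)) ⁻¹' {p} = ξ ⁻¹' {p.1} ∩ η ⁻¹' {p.2} := by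
  ext y; simp [Prod.ext_iff]

/-! ### Conditional information: integrability, limits and the chain rule. -/

section CondInfo

variable {Ω : Type*} {𝒜 : MeasurableSpace Ω} {mΩ : MeasurableSpace Ω} {μ : Measure Ω}
variable {ι : Type*} [Fintype ι]

theorem condInfo_apply (ξ : Ω → ι) (x : Ω) :
    condInfo 𝒜 μ ξ x = -Real.log ((μ⟦ξ ⁻¹' {ξ x}|𝒜⟧) x) := by
  rw [condInfo, Finset.sum_eq_single (ξ x)]
  · rw [indicator_of_mem (by simp)]
  · intro i _ hi
    rw [indicator_of_notMem]
    exact fun h => hi h.symm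
  · simp

theorem condInfo_congr {ι' : Type*} [Fintype ι'] {ξ : Ω → ι}
    {ξ' : Ω → ι'} (h : ∀ x, ξ ⁻¹' {ξ x} = ξ' ⁻¹' {ξ' x}) :
    condInfo 𝒜 μ ξ = condInfo 𝒜 μ ξ' := by
  funext x
  rw [condInfo_apply, condInfo_apply, h]

variable [MeasurableSpace ι] [MeasurableSingletonClass ι]

/-- Keeps every logarithm below away from the default value of `Real.log` at `0`. -/
theorem ae_condProb_cell_pos [IsFiniteMeasure μ] (h𝒜 : 𝒜 ≤ mΩ)
    {ξ : Ω → ι} (hξ : Measurable ξ) : ∀ᵐ x ∂μ, 0 < (μ⟦ξ ⁻¹' {ξ x}|𝒜⟧) x := by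
  have h : ∀ᵐ x ∂μ, ∀ i, x ∈ ξ ⁻¹' {i} → 0 < (μ⟦ξ ⁻¹' {i}|𝒜⟧) x :=
    ae_all_iff.2 fun i => condProb_pos h𝒜 (hξ (measurableSet_singleton i))
  filter_upwards [h] with x hx using hx _ rfl

theorem condInfo_nonneg [IsFiniteMeasure μ] (h𝒜 : 𝒜 ≤ mΩ)
    {ξ : Ω → ι} (hξ : Measurable ξ) : ∀ᵐ x ∂μ, 0 ≤ condInfo 𝒜 μ ξ x := by
  have h : ∀ᵐ x ∂μ, ∀ i, (μ⟦ξ ⁻¹' {i}|𝒜⟧) x ≤ 1 :=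
    ae_all_iff.2 fun i => condProb_le_one h𝒜 (hξ (measurableSet_singleton i))
  filter_upwards [h, ae_condProb_cell_pos h𝒜 hξ] with x hx hp
  rw [condInfo_apply, neg_nonneg]
  exact Real.log_nonpos hp.le (hx _)

theorem measurable_condInfo (h𝒜 : 𝒜 ≤ mΩ)
    {ξ : Ω → ι} (hξ : Measurable ξ) : Measurable (condInfo 𝒜 μ ξ) := by
  refine Measurable.neg (Finset.measurable_fun_sum _ fun i _ => ?_)
  refine Measurable.indicator ?_ (hξ (measurableSet_singleton i))
  exact Real.measurable_log.comp ((stronglyMeasurable_condExp.mono h𝒜).measurable)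

/-- A maximal inequality for conditional probabilities along a filtration. -/
theorem measure_inter_exists_condProb_lt_le [IsFiniteMeasure μ] (ℱ : Filtration ℕ mΩ) {B : Set Ω}
    (hB : MeasurableSet B) {c : ℝ} (hc : 0 ≤ c) :
    μ (B ∩ {x | ∃ n, (μ⟦B|ℱ n⟧) x < c}) ≤ ENNReal.ofReal c * μ univ := by
  set E : ℕ → Set Ω := fun n => {x | (μ⟦B|ℱ n⟧) x < c} with hE
  have hEm : ∀ n, MeasurableSet[ℱ n] (E n) := fun n =>
    (stronglyMeasurable_condExp.measurable : Measurable[ℱ n] (μ⟦B|ℱ n⟧)) measurableSet_Iio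
  -- Split according to the first time at which the conditional probability falls below `c`.
  set D : ℕ → Set Ω := disjointed E with hD
  have hDm : ∀ n, MeasurableSet[ℱ n] (D n) := by
    intro n
    rw [hD, disjointed_eq_inter_compl]
    refine (hEm n).inter (MeasurableSet.iInter fun j => MeasurableSet.iInter fun hj => ?_)
    exact (ℱ.mono hj.le _ (hEm j)).compl
  have hDm' : ∀ n, MeasurableSet (D n) := fun n => ℱ.le n _ (hDm n)
  have hle : ∀ n, μ (B ∩ D n) ≤ ENNReal.ofReal c * μ (D n) := by
    intro n
    have h1 : μ.real (D n ∩ B) ≤ c * μ.real (D n) := by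
      rw [← setIntegral_condProb (ℱ.le n) (hDm n) hB]
      calc ∫ x in D n, (μ⟦B|ℱ n⟧) x ∂μ ≤ ∫ x in D n, c ∂μ :=
            setIntegral_mono_on integrable_condExp.integrableOn (integrable_const _).integrableOn
              (hDm' n) fun x hx => (disjointed_subset E n hx : x ∈ E n).le
        _ = c * μ.real (D n) := by simp [mul_comm]
    rw [inter_comm, ← ofReal_measureReal, ← ofReal_measureReal (s := D n),
      ← ENNReal.ofReal_mul hc]
    exact ENNReal.ofReal_le_ofReal h1
  have hU : B ∩ {x | ∃ n, (μ⟦B|ℱ n⟧) x < c} = ⋃ n, B ∩ D n := by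
    rw [← inter_iUnion, hD, iUnion_disjointed]
    ext x; simp [hE]
  rw [hU]
  calc μ (⋃ n, B ∩ D n) ≤ ∑' n, μ (B ∩ D n) := measure_iUnion_le _
    _ ≤ ∑' n, ENNReal.ofReal c * μ (D n) := ENNReal.tsum_le_tsum hle
    _ = ENNReal.ofReal c * μ (⋃ n, D n) := by
        rw [ENNReal.tsum_mul_left, measure_iUnion (disjoint_disjointed E) hDm']
    _ ≤ ENNReal.ofReal c * μ univ := by gcongr; exact subset_univ _

/-- **Chung's lemma**: the conditional information functions of a finite partition along a
filtration have an integrable common bound. -/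
theorem exists_integrable_bound_condInfo [IsFiniteMeasure μ] (ℱ : Filtration ℕ mΩ)
    {ξ : Ω → ι} (hξ : Measurable ξ) :
    ∃ G : Ω → ℝ, Integrable G μ ∧ ∀ᵐ x ∂μ, ∀ n, |condInfo (ℱ n) μ ξ x| ≤ G x := by
  set H : Ω → ℝ≥0∞ := fun x => ⨆ n, ENNReal.ofReal (condInfo (ℱ n) μ ξ x) with hH
  have hHm : Measurable H := Measurable.iSup fun n => (measurable_condInfo (ℱ.le n) hξ).ennreal_ofReal
  set C : ℝ := Fintype.card ι * μ.real univ with hC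
  have hC0 : 0 ≤ C := by positivity
  have hpos : ∀ᵐ x ∂μ, ∀ n, 0 < (μ⟦ξ ⁻¹' {ξ x}|ℱ n⟧) x :=
    ae_all_iff.2 fun n => ae_condProb_cell_pos (ℱ.le n) hξ
  -- If the information exceeds `t` at some time, the conditional probability of the cell drops
  -- below `exp (-t)`. The maximal inequality, summed over cells, gives an exponential tail for the
  -- supremum, hence integrability by the layer cake formula.
  have htail : ∀ t : ℝ, μ {x | ENNReal.ofReal t < H x} ≤ ENNReal.ofReal (C * Real.exp (-t)) := by
    intro t
    have hsub : ∀ᵐ x ∂μ, x ∈ {x | ENNReal.ofReal t < H x} →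
        x ∈ ⋃ i, ξ ⁻¹' {i} ∩ {x | ∃ n, (μ⟦ξ ⁻¹' {i}|ℱ n⟧) x < Real.exp (-t)} := by
      filter_upwards [hpos] with x hx hxt
      obtain ⟨n, hn⟩ := lt_iSup_iff.1 hxt
      refine mem_iUnion.2 ⟨ξ x, rfl, n, ?_⟩
      have h1 := (ENNReal.ofReal_lt_ofReal_iff'.1 hn).1
      rw [condInfo_apply] at h1
      rw [← Real.log_lt_iff_lt_exp (hx n)]
      linarith
    refine (measure_mono_ae hsub).trans ((measure_iUnion_le _).trans ?_)
    rw [tsum_fintype]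
    refine (Finset.sum_le_sum fun i _ => measure_inter_exists_condProb_lt_le ℱ
      (hξ (measurableSet_singleton i)) (Real.exp_pos (-t)).le).trans ?_
    rw [Finset.sum_const, Finset.card_univ, nsmul_eq_mul, hC, ← ofReal_measureReal,
      ← ENNReal.ofReal_mul (Real.exp_pos _).le, ← ENNReal.ofReal_natCast,
      ← ENNReal.ofReal_mul (by positivity)]
    apply le_of_eq
    congr 1; ring
  have hexp : Tendsto (fun t : ℝ => ENNReal.ofReal (C * Real.exp (-t))) atTop (𝓝 0) := by
    have := (Real.tendsto_exp_neg_atTop_nhds_zero.const_mul C)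
    rw [mul_zero] at this
    simpa using ENNReal.tendsto_ofReal this
  have hfin : ∀ᵐ x ∂μ, H x ≠ ⊤ := by
    have h0 : μ {x | H x = ⊤} = 0 := by
      refine le_antisymm (ge_of_tendsto' hexp fun t => le_trans (measure_mono ?_) (htail t)) bot_le
      intro x hx
      simp only [mem_ofPred_eq] at hx ⊢
      rw [hx]; exact ENNReal.ofReal_lt_top
    exact compl_mem_ae_iff.2 h0
  refine ⟨fun x => (H x).toReal, ⟨hHm.ennreal_toReal.aestronglyMeasurable, ?_⟩, ?_⟩
  · rw [hasFiniteIntegral_iff_ofReal (ae_of_all _ fun x => ENNReal.toReal_nonneg),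
      lintegral_eq_lintegral_meas_lt μ (ae_of_all _ fun x => ENNReal.toReal_nonneg)
        hHm.ennreal_toReal.aemeasurable]
    have hle : ∀ t ∈ Ioi (0 : ℝ), μ {x | t < (H x).toReal} ≤
        ENNReal.ofReal (C * Real.exp (-t)) := by
      intro t ht
      refine le_trans (measure_mono ?_) (htail t)
      intro x hx
      simp only [mem_ofPred_eq] at hx ⊢
      exact (ENNReal.ofReal_lt_iff_lt_toReal (mem_Ioi.1 ht).le (fun h => by
        rw [h] at hx; simp at hx; exact (not_lt.2 hx.le) ht)).2 hx
    refine (setLIntegral_mono_ae' measurableSet_Ioi (ae_of_all _ hle)).trans_lt ?_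
    have hint : IntegrableOn (fun t : ℝ => C * Real.exp (-t)) (Ioi 0) :=
      (integrableOn_exp_neg_Ioi 0).const_mul C
    have := hint.2
    rwa [hasFiniteIntegral_iff_ofReal (ae_of_all _ fun t => by positivity)] at this
  · have h0 : ∀ᵐ x ∂μ, ∀ n, 0 ≤ condInfo (ℱ n) μ ξ x :=
      ae_all_iff.2 fun n => condInfo_nonneg (ℱ.le n) hξ
    filter_upwards [hfin, h0] with x hx h0 n
    rw [abs_of_nonneg (h0 n), ← ENNReal.ofReal_le_iff_le_toReal hx]
    exact le_iSup (fun n => ENNReal.ofReal (condInfo (ℱ n) μ ξ x)) n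

/-- Chung's lemma along a constant filtration. -/
theorem integrable_condInfo [IsFiniteMeasure μ] (h𝒜 : 𝒜 ≤ mΩ)
    {ξ : Ω → ι} (hξ : Measurable ξ) : Integrable (condInfo 𝒜 μ ξ) μ := by
  obtain ⟨G, hG, h⟩ := exists_integrable_bound_condInfo (μ := μ)
    (⟨fun _ => 𝒜, monotone_const, fun _ => h𝒜⟩ : Filtration ℕ mΩ) hξ
  exact hG.mono' (measurable_condInfo h𝒜 hξ).aestronglyMeasurable (h.mono fun x hx => hx 0)

/-- Lévy's upward theorem for each cell; the limit is positive on the cell of `x`, so the logarithm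
is continuous there. -/
theorem tendsto_condInfo [IsFiniteMeasure μ] (ℱ : Filtration ℕ mΩ) {ξ : Ω → ι}
    (hξ : Measurable ξ) :
    ∀ᵐ x ∂μ, Tendsto (fun n => condInfo (ℱ n) μ ξ x) atTop
      (𝓝 (condInfo (⨆ n, ℱ n) μ ξ x)) := by
  have h : ∀ᵐ x ∂μ, ∀ i, Tendsto (fun n => (μ⟦ξ ⁻¹' {i}|ℱ n⟧) x) atTop
      (𝓝 ((μ⟦ξ ⁻¹' {i}|⨆ n, ℱ n⟧) x)) :=
    ae_all_iff.2 fun i => tendsto_ae_condExp _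
  filter_upwards [h, ae_condProb_cell_pos (μ := μ) (iSup_le fun n => ℱ.le n) hξ] with x hx hp
  simp only [condInfo_apply]
  exact ((hx _).log hp.ne').neg

theorem tendsto_integral_condInfo [IsFiniteMeasure μ] (ℱ : Filtration ℕ mΩ) {ξ : Ω → ι}
    (hξ : Measurable ξ) :
    Tendsto (fun n => ∫ x, condInfo (ℱ n) μ ξ x ∂μ) atTop
      (𝓝 (∫ x, condInfo (⨆ n, ℱ n) μ ξ x ∂μ)) := by
  obtain ⟨G, hG, h⟩ := exists_integrable_bound_condInfo (μ := μ) ℱ hξ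
  exact tendsto_integral_of_dominated_convergence G
    (fun n => (measurable_condInfo (ℱ.le n) hξ).aestronglyMeasurable) hG
    (fun n => h.mono fun x hx => hx n) (tendsto_condInfo ℱ hξ)

variable {κ : Type*} [Fintype κ] [mκ : MeasurableSpace κ] [MeasurableSingletonClass κ]
variable {α β : Type*} [mα : MeasurableSpace α] [mβ : MeasurableSpace β]

/-- The chain rule for conditional information. -/
theorem condInfo_prodMk [IsFiniteMeasure μ] {f : Ω → α} (hf : Measurable f) {ξ : Ω → ι}
    (hξ : Measurable ξ) {η : Ω → κ} (hη : Measurable η) :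
    ∀ᵐ x ∂μ, condInfo (mα.comap f) μ (fun y => (ξ y, η y)) x =
      condInfo (mα.comap f) μ η x +
        condInfo (MeasurableSpace.comap (fun y => (f y, η y)) Prod.instMeasurableSpace) μ ξ x := by
  have h : ∀ᵐ x ∂μ, ∀ (i : ι) (c : κ), x ∈ η ⁻¹' {c} → (μ⟦η ⁻¹' {c} ∩ ξ ⁻¹' {i}|mα.comap f⟧) x =
      (μ⟦ξ ⁻¹' {i}|MeasurableSpace.comap (fun y => (f y, η y)) Prod.instMeasurableSpace⟧) x *
        (μ⟦η ⁻¹' {c}|mα.comap f⟧) x :=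
    ae_all_iff.2 fun i => ae_all_iff.2 fun c =>
      condProb_comap_prod_mul hf hη (hξ (measurableSet_singleton i)) c
  filter_upwards [h, ae_condProb_cell_pos (μ := μ) hf.comap_le hη,
    ae_condProb_cell_pos (μ := μ) (hf.prodMk hη).comap_le hξ] with x hx h1 h2
  rw [condInfo_apply, condInfo_apply, condInfo_apply, prodMk_preimage_singleton, inter_comm,
    hx _ _ rfl, Real.log_mul h2.ne' h1.ne']
  ring

/-- Each side is minus the logarithm of the conditional probability of the `η`-cell normalized on
the `ξ`-cell, and on that cell `f` and `f'` carry the same information. -/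
theorem condInfo_prodMk_sub_eq [IsFiniteMeasure μ] {f : Ω → α} {f' : Ω → β} (hf : Measurable f)
    (hf' : Measurable f') {ξ : Ω → ι} (hξ : Measurable ξ) {η : Ω → κ} (hη : Measurable η)
    (hR : ∀ i, ∃ R : β → α, Measurable R ∧ ∀ x, ξ x = i → f x = R (f' x))
    (hT : ∀ i, ∃ T : α → β, Measurable T ∧ ∀ x, ξ x = i → f' x = T (f x)) :
    ∀ᵐ x ∂μ, condInfo (mα.comap f) μ (fun y => (ξ y, η y)) x - condInfo (mα.comap f) μ ξ x =
      condInfo (mβ.comap f') μ (fun y => (ξ y, η y)) x - condInfo (mβ.comap f') μ ξ x := by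
  choose R hRm hR using hR
  choose T hTm hT using hT
  have h : ∀ᵐ x ∂μ, ∀ (i : ι) (c : κ), x ∈ ξ ⁻¹' {i} →
      (μ⟦ξ ⁻¹' {i} ∩ η ⁻¹' {c}|mα.comap f⟧) x * (μ⟦ξ ⁻¹' {i}|mβ.comap f'⟧) x =
      (μ⟦ξ ⁻¹' {i} ∩ η ⁻¹' {c}|mβ.comap f'⟧) x * (μ⟦ξ ⁻¹' {i}|mα.comap f⟧) x :=
    ae_all_iff.2 fun i => ae_all_iff.2 fun c =>
      condProb_comap_mul_eq hf hf' (hRm i) (hTm i) (hξ (measurableSet_singleton i))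
        (hη (measurableSet_singleton c)) (fun x hx => hR i x hx) (fun x hx => hT i x hx)
  filter_upwards [h, ae_condProb_cell_pos (μ := μ) hf.comap_le hξ,
    ae_condProb_cell_pos (μ := μ) hf'.comap_le hξ,
    ae_condProb_cell_pos (μ := μ) hf.comap_le (hξ.prodMk hη),
    ae_condProb_cell_pos (μ := μ) hf'.comap_le (hξ.prodMk hη)] with x hx h1 h2 h3 h4
  simp only [prodMk_preimage_singleton] at h3 h4
  simp only [condInfo_apply, prodMk_preimage_singleton]
  have := congrArg Real.log (hx _ (η x) rfl)
  rw [Real.log_mul h3.ne' h2.ne', Real.log_mul h4.ne' h1.ne'] at this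
  linarith

theorem condInfo_comp [IsFiniteMeasure μ] {T : Ω → Ω} (hT : MeasurePreserving T μ μ)
    {f : Ω → α} (hf : Measurable f) {η : Ω → κ} (hη : Measurable η) :
    ∀ᵐ x ∂μ, condInfo (mα.comap (f ∘ T)) μ (η ∘ T) x = condInfo (mα.comap f) μ η (T x) := by
  have h : ∀ᵐ x ∂μ, ∀ c : κ, (μ⟦T ⁻¹' (η ⁻¹' {c})|mα.comap (f ∘ T)⟧) x =
      (μ⟦η ⁻¹' {c}|mα.comap f⟧) (T x) :=
    ae_all_iff.2 fun c => condProb_comap_comp hT hf (hη (measurableSet_singleton c))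
  filter_upwards [h] with x hx
  rw [condInfo_apply, condInfo_apply, preimage_comp, hx]
  rfl

end CondInfo

theorem integral_comp_measurePreserving {Ω : Type*} [MeasurableSpace Ω] {μ : Measure Ω}
    {T : Ω → Ω} (hT : MeasurePreserving T μ μ) {g : Ω → ℝ} (hg : AEStronglyMeasurable g μ) :
    ∫ x, g (T x) ∂μ = ∫ x, g x ∂μ := by
  have h := integral_map hT.measurable.aemeasurable (f := g) (by rwa [hT.map_eq])
  rw [hT.map_eq] at h
  exact h.symm

/-! ### Words of the full shift and the σ-algebras they generate. -/

section Symbolic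

variable {ℓ : ℕ}

theorem iterate_leftShift_apply (x : ℕ → Fin ℓ) (i k : ℕ) : leftShift^[i] x k = x (k + i) := by
  induction i generalizing x with
  | zero => rfl
  | succ i ih => rw [Function.iterate_succ_apply, ih, leftShift]; congr 1

theorem joinPartition_leftShift (n : ℕ) (x : ℕ → Fin ℓ) :
    joinPartition leftShift firstSymbol n x = fun i : Fin n => x i := by
  funext i
  rw [joinPartition, firstSymbol, iterate_leftShift_apply, Nat.zero_add]

theorem measurable_leftShift : Measurable (leftShift : (ℕ → Fin ℓ) → ℕ → Fin ℓ) :=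
  measurable_pi_lambda _ fun n => measurable_pi_apply (n + 1)

theorem measurable_firstSymbol : Measurable (firstSymbol : (ℕ → Fin ℓ) → Fin ℓ) :=
  measurable_pi_apply 0

theorem measurable_joinPartition {Ω ι : Type*} [MeasurableSpace Ω] [MeasurableSpace ι] {T : Ω → Ω}
    (hT : Measurable T) {ξ : Ω → ι} (hξ : Measurable ξ) (n : ℕ) :
    Measurable (joinPartition T ξ n) :=
  measurable_pi_lambda _ fun i => hξ.comp (hT.iterate i)

theorem measurable_word (n : ℕ) :
    Measurable (joinPartition (leftShift (ℓ := ℓ)) firstSymbol n) :=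
  measurable_joinPartition measurable_leftShift measurable_firstSymbol n

theorem word_succ_preimage (n : ℕ) (x : ℕ → Fin ℓ) :
    joinPartition leftShift firstSymbol (n + 1) ⁻¹' {joinPartition leftShift firstSymbol (n + 1) x} =
      (fun y => (firstSymbol y, joinPartition leftShift firstSymbol n (leftShift y))) ⁻¹'
        {(firstSymbol x, joinPartition leftShift firstSymbol n (leftShift x))} := by
  ext y
  simp only [mem_preimage, mem_singleton_iff, joinPartition_leftShift, Prod.mk.injEq, firstSymbol,
    leftShift, funext_iff]
  constructor
  · intro h
    exact ⟨h 0, fun i => by simpa using h i.succ⟩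
  · rintro ⟨h0, h⟩ i
    refine Fin.cases ?_ (fun j => ?_) i
    · exact h0
    · simpa using h j

theorem comap_prod_word_mono {α : Type*} [mα : MeasurableSpace α] (f : (ℕ → Fin ℓ) → α) :
    Monotone fun n => MeasurableSpace.comap
      (fun y => (f y, joinPartition leftShift firstSymbol n y)) Prod.instMeasurableSpace := by
  refine monotone_nat_of_le_succ fun n => ?_
  have h : (fun y => (f y, joinPartition leftShift firstSymbol n y)) =
      (Prod.map id fun (w : Fin (n + 1) → Fin ℓ) (i : Fin n) => w i.castSucc) ∘
        fun y => (f y, joinPartition leftShift firstSymbol (n + 1) y) := rfl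
  rw [h, ← MeasurableSpace.comap_comp]
  refine MeasurableSpace.comap_mono (Measurable.comap_le ?_)
  exact measurable_id.prodMap (measurable_pi_lambda _ fun i => measurable_pi_apply _)

theorem iSup_comap_prod_word {α : Type*} [mα : MeasurableSpace α] {f : (ℕ → Fin ℓ) → α}
    (hf : Measurable f) : ⨆ n, MeasurableSpace.comap
      (fun y => (f y, joinPartition leftShift firstSymbol n y)) Prod.instMeasurableSpace =
      MeasurableSpace.pi := by
  refine le_antisymm (iSup_le fun n => (hf.prodMk (measurable_word n)).comap_le) ?_
  refine iSup_le fun i => ?_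
  refine le_trans ?_ (le_iSup _ (i + 1))
  rintro _ ⟨S, hS, rfl⟩
  refine ⟨(fun p : α × (Fin (i + 1) → Fin ℓ) => p.2 (Fin.last i)) ⁻¹' S,
    ((measurable_pi_apply _).comp measurable_snd) hS, ?_⟩
  ext y
  simp [joinPartition_leftShift]

end Symbolic

/-! ### The recursion for the information of words given a shift-compatible map. -/

section Recursion

variable {ℓ : ℕ} {α : Type*} [mα : MeasurableSpace α]

/-- The `σ`-algebras generated by `f ∘ σ` and the symbols `x_2, …, x_{n+1}`. -/
def shiftedFiltration {f : (ℕ → Fin ℓ) → α} (hf : Measurable f) :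
    Filtration ℕ (MeasurableSpace.pi : MeasurableSpace (ℕ → Fin ℓ)) where
  seq n := MeasurableSpace.comap
    (fun y => (f (leftShift y), joinPartition leftShift firstSymbol n (leftShift y)))
    Prod.instMeasurableSpace
  mono' i j hij := by
    have := MeasurableSpace.comap_mono (g := leftShift (ℓ := ℓ)) (comap_prod_word_mono f hij)
    rwa [MeasurableSpace.comap_comp, MeasurableSpace.comap_comp] at this
  le' n := ((hf.comp measurable_leftShift).prodMk
    ((measurable_word n).comp measurable_leftShift)).comap_le

theorem iSup_shiftedFiltration {f : (ℕ → Fin ℓ) → α} (hf : Measurable f) :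
    ⨆ n, shiftedFiltration hf n = MeasurableSpace.comap leftShift MeasurableSpace.pi := by
  have h := congrArg (MeasurableSpace.comap (leftShift (ℓ := ℓ))) (iSup_comap_prod_word hf)
  rw [MeasurableSpace.comap_iSup] at h
  simp only [MeasurableSpace.comap_comp] at h
  exact h

/-- The information gained on the first symbol when conditioning on `f ∘ σ` is replaced by
conditioning on `f`. -/
noncomputable def infoDefect (m : Measure (ℕ → Fin ℓ)) (f : (ℕ → Fin ℓ) → α) (x : ℕ → Fin ℓ) : ℝ :=
  condInfo (mα.comap f) m firstSymbol x - condInfo (mα.comap (f ∘ leftShift)) m firstSymbol x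

theorem measurable_infoDefect {m : Measure (ℕ → Fin ℓ)} {f : (ℕ → Fin ℓ) → α} (hf : Measurable f) :
    Measurable (infoDefect m f) :=
  (measurable_condInfo hf.comap_le measurable_firstSymbol).sub
    (measurable_condInfo (hf.comp measurable_leftShift).comap_le measurable_firstSymbol)

variable {m : Measure (ℕ → Fin ℓ)} [IsProbabilityMeasure m]

theorem integrable_infoDefect {f : (ℕ → Fin ℓ) → α} (hf : Measurable f) :
    Integrable (infoDefect m f) m :=
  (integrable_condInfo hf.comap_le measurable_firstSymbol).sub
    (integrable_condInfo (hf.comp measurable_leftShift).comap_le measurable_firstSymbol)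

/-- `f` and `f ∘ σ` determine each other, measurably, on each first level cylinder. -/
structure ShiftCompatible (f : (ℕ → Fin ℓ) → α) : Prop where
  measurable : Measurable f
  recover : ∀ i, ∃ R : α → α, Measurable R ∧ ∀ x, firstSymbol x = i → f x = R (f (leftShift x))
  shift : ∀ i, ∃ R : α → α, Measurable R ∧ ∀ x, firstSymbol x = i → f (leftShift x) = R (f x)

/-- Split the word into its first symbol and the word of the shifted point. Passing from `f` to `f ∘
σ` costs exactly `infoDefect`; then the chain rule separates the two pieces, and invariance moves
the second to `σ x`. -/
theorem condInfo_word_succ (hm : MeasurePreserving leftShift m m) {f : (ℕ → Fin ℓ) → α}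
    (hf : ShiftCompatible f) (n : ℕ) :
    ∀ᵐ x ∂m, condInfo (mα.comap f) m (joinPartition leftShift firstSymbol (n + 1)) x =
      infoDefect m f x + condInfo (shiftedFiltration hf.measurable n) m firstSymbol x +
        condInfo (mα.comap f) m (joinPartition leftShift firstSymbol n) (leftShift x) := by
  have hfσ := hf.measurable.comp measurable_leftShift
  have hw := (measurable_word (ℓ := ℓ) n).comp measurable_leftShift
  rw [condInfo_congr (word_succ_preimage n)]
  filter_upwards [condInfo_prodMk_sub_eq (μ := m) hf.measurable hfσ measurable_firstSymbol hw hf.recover hf.shift,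
    condInfo_prodMk (μ := m) hfσ measurable_firstSymbol hw,
    condInfo_comp hm hf.measurable (measurable_word (ℓ := ℓ) n)] with x h1 h2 h3
  simp only [Function.comp_apply] at h1 h2
  rw [h3] at h2
  rw [infoDefect]
  change _ = _ + condInfo (MeasurableSpace.comap (fun y => ((f ∘ leftShift) y,
    (joinPartition leftShift firstSymbol n ∘ leftShift) y)) Prod.instMeasurableSpace) m
      firstSymbol x + _
  simp only [Function.comp_apply] at h2 ⊢
  linarith

theorem condInfo_word_zero {𝒜 : MeasurableSpace (ℕ → Fin ℓ)}
    (h𝒜 : 𝒜 ≤ (MeasurableSpace.pi : MeasurableSpace (ℕ → Fin ℓ))) (x : ℕ → Fin ℓ) :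
    condInfo 𝒜 m (joinPartition leftShift firstSymbol 0) x = 0 := by
  have : joinPartition leftShift firstSymbol 0 ⁻¹' {joinPartition leftShift firstSymbol 0 x} =
      univ := by
    ext y
    simp only [mem_preimage, mem_singleton_iff, mem_univ, iff_true]
    exact Subsingleton.elim _ _
  rw [condInfo_apply, this, indicator_univ, condExp_const h𝒜]
  simp

theorem condInfo_word_eq_sum (hm : MeasurePreserving leftShift m m) {f : (ℕ → Fin ℓ) → α}
    (hf : ShiftCompatible f) :
    ∀ᵐ x ∂m, ∀ n, condInfo (mα.comap f) m (joinPartition leftShift firstSymbol n) x =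
      ∑ j ∈ Finset.range n, (infoDefect m f (leftShift^[j] x) +
        condInfo (shiftedFiltration hf.measurable (n - 1 - j)) m firstSymbol (leftShift^[j] x)) := by
  have h : ∀ᵐ x ∂m, ∀ j n, condInfo (mα.comap f) m (joinPartition leftShift firstSymbol (n + 1))
      (leftShift^[j] x) = infoDefect m f (leftShift^[j] x) +
        condInfo (shiftedFiltration hf.measurable n) m firstSymbol (leftShift^[j] x) +
        condInfo (mα.comap f) m (joinPartition leftShift firstSymbol n)
          (leftShift (leftShift^[j] x)) :=
    ae_all_iff.2 fun j => (hm.iterate j).quasiMeasurePreserving.ae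
      (ae_all_iff.2 fun n => condInfo_word_succ hm hf n)
  filter_upwards [h] with x hx
  -- The starting time `i` must be free, since the recursion passes from `x` to its shift.
  have key : ∀ n i, condInfo (mα.comap f) m (joinPartition leftShift firstSymbol n)
      (leftShift^[i] x) = ∑ j ∈ Finset.range n, (infoDefect m f (leftShift^[j + i] x) +
        condInfo (shiftedFiltration hf.measurable (n - 1 - j)) m firstSymbol (leftShift^[j + i] x)) := by
    intro n
    induction n with
    | zero => intro i; simpa using condInfo_word_zero hf.measurable.comap_le _
    | succ n ih =>
      intro i
      rw [hx, ← Function.iterate_succ_apply' leftShift i x, ih, Finset.sum_range_succ']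
      simp only [Nat.zero_add, Nat.add_sub_cancel, Nat.sub_zero]
      rw [add_comm]
      congr 1
      refine Finset.sum_congr rfl fun j _ => ?_
      rw [Nat.add_succ, ← Nat.succ_add, Nat.sub_sub, Nat.add_comm 1 j]
  intro n
  simpa using key n 0

/-- A relative Shannon–McMillan–Breiman theorem. -/
theorem tendsto_condInfo_word (hm : MeasurePreserving leftShift m m) {f : (ℕ → Fin ℓ) → α}
    (hf : ShiftCompatible f) :
    ∀ᵐ x ∂m, Tendsto (fun n : ℕ => (n : ℝ)⁻¹ *
        condInfo (mα.comap f) m (joinPartition leftShift firstSymbol n) x) atTop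
      (𝓝 ((m[fun x => infoDefect m f x + condInfo (MeasurableSpace.comap leftShift
        MeasurableSpace.pi) m firstSymbol x | MeasurableSpace.invariants leftShift]) x)) := by
  obtain ⟨G, hG, hGb⟩ := exists_integrable_bound_condInfo (μ := m) (shiftedFiltration hf.measurable)
    measurable_firstSymbol
  have hlim := tendsto_condInfo (μ := m) (shiftedFiltration hf.measurable) measurable_firstSymbol
  rw [iSup_shiftedFiltration] at hlim
  have hD := measurable_infoDefect (m := m) hf.measurable
  -- At time `j` the remaining word has `n - 1 - j` letters beyond the first, which is the
  -- antidiagonal pattern of Maker's theorem.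
  have := tendsto_average_of_dominated hm
    (g := fun n x => infoDefect m f x + condInfo (shiftedFiltration hf.measurable n) m firstSymbol x)
    (g' := fun x => infoDefect m f x +
      condInfo (MeasurableSpace.comap leftShift MeasurableSpace.pi) m firstSymbol x)
    (G := fun x => |infoDefect m f x| + G x)
    (fun n => hD.add (measurable_condInfo ((shiftedFiltration hf.measurable).le n) measurable_firstSymbol))
    (hD.add (measurable_condInfo measurable_leftShift.comap_le measurable_firstSymbol))
    ((integrable_infoDefect hf.measurable).abs.add hG)
    (hGb.mono fun x hx n => (abs_add_le _ _).trans (add_le_add_right (hx n) _))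
    (hlim.mono fun x hx => hx.const_add _)
  filter_upwards [this, condInfo_word_eq_sum hm hf] with x h1 h2
  simpa only [h2] using h1

/-- By invariance of `m` the integrated terms do not depend on the time `j`, so the average is a
Cesàro mean read backwards. -/
theorem tendsto_integral_condInfo_word (hm : MeasurePreserving leftShift m m)
    {f : (ℕ → Fin ℓ) → α} (hf : ShiftCompatible f) :
    Tendsto (fun n : ℕ => (n : ℝ)⁻¹ *
        ∫ x, condInfo (mα.comap f) m (joinPartition leftShift firstSymbol n) x ∂m) atTop
      (𝓝 (∫ x, infoDefect m f x ∂m + ∫ x, condInfo (MeasurableSpace.comap leftShift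
        MeasurableSpace.pi) m firstSymbol x ∂m)) := by
  have hlim := tendsto_integral_condInfo (μ := m) (shiftedFiltration hf.measurable) measurable_firstSymbol
  rw [iSup_shiftedFiltration] at hlim
  have hces := (hlim.const_add (∫ x, infoDefect m f x ∂m)).cesaro
  refine hces.congr fun n => ?_
  congr 1
  have hg : ∀ k, Integrable (condInfo (shiftedFiltration hf.measurable k) m firstSymbol) m := fun k =>
    integrable_condInfo ((shiftedFiltration hf.measurable).le k) measurable_firstSymbol
  have hsum : ∀ j k, Integrable (fun x => infoDefect m f (leftShift^[j] x) +
      condInfo (shiftedFiltration hf.measurable k) m firstSymbol (leftShift^[j] x)) m := fun j k =>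
    (hm.iterate j).integrable_comp_of_integrable ((integrable_infoDefect hf.measurable).add (hg k))
  have hinv : ∀ j k, ∫ x, (infoDefect m f (leftShift^[j] x) +
      condInfo (shiftedFiltration hf.measurable k) m firstSymbol (leftShift^[j] x)) ∂m =
      ∫ x, infoDefect m f x ∂m + ∫ x, condInfo (shiftedFiltration hf.measurable k) m firstSymbol x ∂m := by
    intro j k
    rw [← integral_add (integrable_infoDefect hf.measurable) (hg k)]
    exact integral_comp_measurePreserving (hm.iterate j)
      ((integrable_infoDefect hf.measurable).add (hg k)).1
  rw [integral_congr_ae ((condInfo_word_eq_sum hm hf).mono fun x hx => hx n),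
    integral_finsetSum _ fun j _ => hsum j _]
  simp only [hinv]
  exact (Finset.sum_range_reflect (fun i => ∫ x, infoDefect m f x ∂m +
    ∫ x, condInfo (shiftedFiltration hf.measurable i) m firstSymbol x ∂m) n).symm

end Recursion

/-! ### Entropy of the shift as entropy of the first symbol given the future. -/

section KolmogorovSinai

section Finite

variable {Ω : Type*} {mΩ : MeasurableSpace Ω} {μ : Measure Ω} [IsProbabilityMeasure μ]
variable {ι : Type*} [Fintype ι]

theorem condInfo_bot (ξ : Ω → ι) {x : Ω} (hξ : MeasurableSet (ξ ⁻¹' {ξ x})) :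
    condInfo ⊥ μ ξ x = -Real.log (μ.real (ξ ⁻¹' {ξ x})) := by
  rw [condInfo_apply, condExp_bot, integral_indicator hξ]
  simp

variable [MeasurableSpace ι] [MeasurableSingletonClass ι]

theorem ae_measureReal_cell_pos {ξ : Ω → ι} (hξ : Measurable ξ) :
    ∀ᵐ x ∂μ, 0 < μ.real (ξ ⁻¹' {ξ x}) := by
  filter_upwards [ae_condProb_cell_pos (μ := μ) bot_le hξ] with x hx
  rw [condExp_bot, integral_indicator (hξ (measurableSet_singleton _))] at hx
  simpa using hx

theorem integral_comp_label {ξ : Ω → ι} (hξ : Measurable ξ) (φ : ι → ℝ) :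
    ∫ x, φ (ξ x) ∂μ = ∑ i, μ.real (ξ ⁻¹' {i}) * φ i := by
  have : IsProbabilityMeasure (μ.map ξ) := Measure.isProbabilityMeasure_map hξ.aemeasurable
  rw [← integral_map (μ := μ) hξ.aemeasurable (f := φ)
    (measurable_of_finite φ).aestronglyMeasurable, integral_fintype Integrable.of_finite]
  simp [map_measureReal_apply hξ (measurableSet_singleton _)]

theorem sum_measureReal_cell {ξ : Ω → ι} (hξ : Measurable ξ) :
    ∑ i, μ.real (ξ ⁻¹' {i}) = 1 := by
  have := integral_comp_label (μ := μ) hξ fun _ => (1 : ℝ)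
  simpa using this.symm

theorem partEntropy_eq_integral {ξ : Ω → ι} (hξ : Measurable ξ) :
    partEntropy μ ξ = ∫ x, condInfo ⊥ μ ξ x ∂μ := by
  simp only [condInfo_bot ξ (hξ (measurableSet_singleton _))]
  rw [integral_comp_label hξ fun i => -Real.log (μ.real (ξ ⁻¹' {i})), partEntropy]
  refine Finset.sum_congr rfl fun i _ => ?_
  rw [Real.negMulLog]; ring

/-- Gibbs' inequality. -/
theorem partEntropy_le_integral_neg_log {ξ : Ω → ι} (hξ : Measurable ξ) {q : ι → ℝ}
    (hq0 : ∀ i, 0 ≤ q i) (hq1 : ∑ i, q i ≤ 1) (hq : ∀ i, 0 < μ.real (ξ ⁻¹' {i}) → 0 < q i) :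
    partEntropy μ ξ ≤ ∫ x, -Real.log (q (ξ x)) ∂μ := by
  rw [integral_comp_label hξ fun i => -Real.log (q i), partEntropy, ← sub_nonpos,
    ← Finset.sum_sub_distrib]
  -- This is `log t ≤ t - 1` at `t = q i / μ(ξ = i)`.
  have h : ∀ i, Real.negMulLog (μ.real (ξ ⁻¹' {i})) - μ.real (ξ ⁻¹' {i}) * -Real.log (q i) ≤
      q i - μ.real (ξ ⁻¹' {i}) := by
    intro i
    rcases (measureReal_nonneg (μ := μ) (s := ξ ⁻¹' {i})).eq_or_lt with h0 | h0
    · rw [← h0]; simpa using hq0 i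
    · have hqi := hq i h0
      have h1 := Real.log_le_sub_one_of_pos (div_pos hqi h0)
      rw [Real.log_div hqi.ne' h0.ne'] at h1
      have h2 := mul_le_mul_of_nonneg_left h1 h0.le
      have h3 : μ.real (ξ ⁻¹' {i}) * (q i / μ.real (ξ ⁻¹' {i}) - 1) =
        q i - μ.real (ξ ⁻¹' {i}) := by field_simp
      rw [h3] at h2
      rw [Real.negMulLog]
      linarith
  refine (Finset.sum_le_sum fun i _ => h i).trans ?_
  rw [Finset.sum_sub_distrib, sum_measureReal_cell hξ]
  linarith

theorem partEntropy_le_prodMk {κ : Type*} [Fintype κ] [MeasurableSpace κ]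
    [MeasurableSingletonClass κ] {ξ : Ω → ι} (hξ : Measurable ξ) {η : Ω → κ}
    (hη : Measurable η) : partEntropy μ ξ ≤ partEntropy μ fun x => (ξ x, η x) := by
  rw [partEntropy_eq_integral hξ, partEntropy_eq_integral (hξ.prodMk hη)]
  refine integral_mono_ae (integrable_condInfo bot_le hξ)
    (integrable_condInfo bot_le (hξ.prodMk hη)) ?_
  filter_upwards [ae_measureReal_cell_pos (μ := μ) (hξ.prodMk hη)] with x hx
  rw [condInfo_bot _ (hξ (measurableSet_singleton _)),
    condInfo_bot _ ((hξ.prodMk hη) (measurableSet_singleton _))]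
  refine neg_le_neg (Real.log_le_log hx (measureReal_mono ?_))
  rw [prodMk_preimage_singleton]
  exact inter_subset_left

end Finite

variable {ℓ : ℕ} {m : Measure (ℕ → Fin ℓ)} [IsProbabilityMeasure m]

/-- The subword of length `N` of `w` starting at `j`. -/
def subword {n N : ℕ} (w : Fin (n + N) → Fin ℓ) (j : Fin n) (i : Fin N) : Fin ℓ :=
  w ⟨j + i, by omega⟩

theorem subword_joinPartition (n N : ℕ) (j : Fin n) (x : ℕ → Fin ℓ) :
    subword (joinPartition leftShift firstSymbol (n + N) x) j =
      joinPartition leftShift firstSymbol N (leftShift^[j] x) := by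
  funext i
  simp only [subword, joinPartition_leftShift, iterate_leftShift_apply]
  rw [Nat.add_comm]

/-- The bracket is the conditional entropy of `ξ` given the first `N` symbols. Gibbs' inequality is
applied to the model in which, given the word of length `n + N`, the `ξ`-labels at times `j < n` are
independent, each governed by the `N` symbols starting at `j`. -/
theorem partEntropy_joinPartition_le (hm : MeasurePreserving leftShift m m) {k : ℕ}
    {ξ : (ℕ → Fin ℓ) → Fin k} (hξ : Measurable ξ) (n N : ℕ) :
    partEntropy m (joinPartition leftShift ξ n) ≤
      partEntropy m (joinPartition leftShift firstSymbol (n + N)) +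
        n * (partEntropy m (fun x => (ξ x, joinPartition leftShift firstSymbol N x)) -
          partEntropy m (joinPartition leftShift firstSymbol N)) := by
  set η := joinPartition (leftShift (ℓ := ℓ)) firstSymbol N with hη
  have hηm : Measurable η := measurable_word N
  have hξη := hξ.prodMk hηm
  set β := joinPartition (leftShift (ℓ := ℓ)) firstSymbol (n + N) with hβ
  have hβm : Measurable β := measurable_word (n + N)
  have hαm := measurable_joinPartition measurable_leftShift hξ n
  set q : Fin k → (Fin N → Fin ℓ) → ℝ := fun a v =>
    m.real ((fun x => (ξ x, η x)) ⁻¹' {(a, v)}) / m.real (η ⁻¹' {v}) with hq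
  have hq0 : ∀ a v, 0 ≤ q a v := fun a v => div_nonneg measureReal_nonneg measureReal_nonneg
  have hq1 : ∀ v, ∑ a, q a v ≤ 1 := by
    intro v
    rw [hq, ← Finset.sum_div]
    have : ∑ a, m.real ((fun x => (ξ x, η x)) ⁻¹' {(a, v)}) = m.real (η ⁻¹' {v}) := by
      rw [← measureReal_biUnion_finset]
      · congr 1
        ext x; simp
      · intro a _ b _ hab
        refine Disjoint.preimage _ ?_
        simpa using hab
      · exact fun a _ => hξη (measurableSet_singleton _)
    rw [this]
    -- On a null cell the quotient is `0 / 0 = 0`, so the sum is only bounded by `1`.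
    exact div_self_le_one _
  set Q : (Fin n → Fin k) × (Fin (n + N) → Fin ℓ) → ℝ := fun p =>
    m.real (β ⁻¹' {p.2}) * ∏ j, q (p.1 j) (subword p.2 j) with hQ
  have hsub : ∀ (p : (Fin n → Fin k) × (Fin (n + N) → Fin ℓ)) (j : Fin n),
      m.real ((fun x => (joinPartition leftShift ξ n x, β x)) ⁻¹' {p}) ≤
        m.real ((fun x => (ξ x, η x)) ⁻¹' {(p.1 j, subword p.2 j)}) := by
    intro p j
    rw [measureReal_def, measureReal_def, ← (hm.iterate j).measure_preimage
      (hξη (measurableSet_singleton _)).nullMeasurableSet]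
    refine ENNReal.toReal_mono (measure_ne_top _ _) (measure_mono ?_)
    rintro x rfl
    simp only [mem_preimage, mem_singleton_iff, hβ, subword_joinPartition]
    rfl
  have hQpos : ∀ p, 0 < m.real ((fun x => (joinPartition leftShift ξ n x, β x)) ⁻¹' {p}) →
      0 < m.real (β ⁻¹' {p.2}) ∧ ∀ j, 0 < m.real ((fun x => (ξ x, η x)) ⁻¹'
        {(p.1 j, subword p.2 j)}) ∧ 0 < m.real (η ⁻¹' {subword p.2 j}) := by
    intro p hp
    refine ⟨hp.trans_le (measureReal_mono ?_), fun j => ?_⟩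
    · rw [prodMk_preimage_singleton]; exact inter_subset_right
    · have h1 := hp.trans_le (hsub p j)
      refine ⟨h1, h1.trans_le (measureReal_mono ?_)⟩
      rw [prodMk_preimage_singleton]; exact inter_subset_right
  have hGibbs := partEntropy_le_integral_neg_log (μ := m) (hαm.prodMk hβm) (q := Q)
    (fun p => mul_nonneg measureReal_nonneg (Finset.prod_nonneg fun j _ => hq0 _ _))
    (by
      -- For a fixed word, the sum over all label sequences factors into a product of sums bounded
      -- by `1`.
      rw [Fintype.sum_prod_type_right, ← sum_measureReal_cell (μ := m) hβm]
      refine Finset.sum_le_sum fun w _ => ?_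
      simp only [hQ]
      rw [← Finset.mul_sum]
      refine mul_le_of_le_one_right measureReal_nonneg ?_
      have := Finset.prod_univ_sum (fun _ : Fin n => (Finset.univ : Finset (Fin k)))
        fun j a => q a (subword w j)
      rw [Fintype.piFinset_univ] at this
      rw [← this]
      exact Finset.prod_le_one (fun j _ => Finset.sum_nonneg fun a _ => hq0 _ _)
        fun j _ => hq1 _)
    (fun p hp => mul_pos (hQpos p hp).1 (Finset.prod_pos fun j _ =>
      div_pos ((hQpos p hp).2 j).1 ((hQpos p hp).2 j).2))
  refine (partEntropy_le_prodMk hαm hβm).trans (hGibbs.trans (le_of_eq ?_))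
  set D : (ℕ → Fin ℓ) → ℝ := fun x =>
    condInfo ⊥ m (fun x => (ξ x, η x)) x - condInfo ⊥ m η x with hD
  have hDi : Integrable D m := (integrable_condInfo bot_le hξη).sub (integrable_condInfo bot_le hηm)
  have hpt : ∀ᵐ x ∂m, -Real.log (Q (joinPartition leftShift ξ n x, β x)) =
      condInfo ⊥ m β x + ∑ j : Fin n, D (leftShift^[j] x) := by
    filter_upwards [ae_measureReal_cell_pos (μ := m) (hαm.prodMk hβm)] with x hx
    obtain ⟨h1, h2⟩ := hQpos _ hx
    simp only [hQ]
    rw [Real.log_mul h1.ne' (Finset.prod_pos fun j _ => div_pos (h2 j).1 (h2 j).2).ne',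
      Real.log_prod fun j _ => (div_pos (h2 j).1 (h2 j).2).ne', neg_add,
      condInfo_bot _ (hβm (measurableSet_singleton _)), ← Finset.sum_neg_distrib]
    congr 1
    refine Finset.sum_congr rfl fun j _ => ?_
    simp only [hD]
    rw [Real.log_div (h2 j).1.ne' (h2 j).2.ne', condInfo_bot η (hηm (measurableSet_singleton _)),
      condInfo_bot (fun x => (ξ x, η x)) (hξη (measurableSet_singleton _))]
    simp only [hβ, subword_joinPartition, hη, joinPartition]
    ring
  have hDit : ∀ j : Fin n, Integrable (fun x => D (leftShift^[j] x)) m := fun j =>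
    (hm.iterate j).integrable_comp_of_integrable hDi
  have hDint : ∀ j : Fin n, ∫ x, D (leftShift^[j] x) ∂m = ∫ x, D x ∂m := fun j =>
    integral_comp_measurePreserving (hm.iterate j) hDi.1
  rw [integral_congr_ae hpt, integral_add (integrable_condInfo bot_le hβm)
    (integrable_finsetSum _ fun j _ => hDit j), integral_finsetSum _ fun j _ => hDit j]
  simp only [hDint]
  rw [Finset.sum_const, Finset.card_univ, Fintype.card_fin, nsmul_eq_mul, hD,
    integral_sub (integrable_condInfo bot_le hξη) (integrable_condInfo bot_le hηm),
    partEntropy_eq_integral hξη, partEntropy_eq_integral hηm, partEntropy_eq_integral hβm]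

/-- A constant map turns the relative statements into absolute ones; its `infoDefect` is zero. -/
theorem shiftCompatible_const : ShiftCompatible fun _ : ℕ → Fin ℓ => () :=
  ⟨measurable_const, fun _ => ⟨id, measurable_id, fun _ _ => rfl⟩,
    fun _ => ⟨id, measurable_id, fun _ _ => rfl⟩⟩

theorem tendsto_partEntropy_word (hm : MeasurePreserving leftShift m m) :
    Tendsto (fun n : ℕ => partEntropy m (joinPartition leftShift firstSymbol n) / n) atTop
      (𝓝 (∫ x, condInfo (MeasurableSpace.comap leftShift MeasurableSpace.pi) m firstSymbol x
        ∂m)) := by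
  have h := tendsto_integral_condInfo_word hm (shiftCompatible_const (ℓ := ℓ))
  have h0 : ∫ x, infoDefect m (fun _ : ℕ → Fin ℓ => ()) x ∂m = 0 := by
    have : infoDefect m (fun _ : ℕ → Fin ℓ => ()) = fun _ => 0 := by
      funext x
      exact sub_self _
    rw [this, integral_zero]
  rw [h0, zero_add] at h
  refine h.congr fun n => ?_
  rw [MeasurableSpace.comap_const, ← partEntropy_eq_integral (measurable_word n), div_eq_inv_mul]

/-- The difference is the conditional entropy of `ξ` given the first `N` symbols. These generate the
whole σ-algebra, given which `ξ` carries no information. -/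
theorem tendsto_partEntropy_prodMk_sub {k : ℕ} {ξ : (ℕ → Fin ℓ) → Fin k} (hξ : Measurable ξ) :
    Tendsto (fun N => partEntropy m (fun x => (ξ x, joinPartition leftShift firstSymbol N x)) -
      partEntropy m (joinPartition leftShift firstSymbol N)) atTop (𝓝 0) := by
  have hf : Measurable fun _ : ℕ → Fin ℓ => () := measurable_const
  let ℱ : Filtration ℕ (MeasurableSpace.pi : MeasurableSpace (ℕ → Fin ℓ)) :=
    ⟨_, comap_prod_word_mono (fun _ : ℕ → Fin ℓ => ()),
      fun n => (hf.prodMk (measurable_word n)).comap_le⟩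
  have h := tendsto_integral_condInfo (μ := m) ℱ hξ
  have hsup : ⨆ n, ℱ n = (MeasurableSpace.pi : MeasurableSpace (ℕ → Fin ℓ)) :=
    iSup_comap_prod_word hf
  rw [hsup] at h
  have h0 : ∀ x, condInfo MeasurableSpace.pi m ξ x = 0 := by
    intro x
    have hS : MeasurableSet (ξ ⁻¹' {ξ x}) := hξ (measurableSet_singleton _)
    rw [condInfo_apply, condExp_of_stronglyMeasurable le_rfl (stronglyMeasurable_const.indicator hS)
      ((integrable_const _).indicator hS), indicator_of_mem (by simp)]
    simp
  simp only [h0, integral_zero] at h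
  refine h.congr fun N => ?_
  have hc := condInfo_prodMk (μ := m) hf hξ (measurable_word (ℓ := ℓ) N)
  rw [MeasurableSpace.comap_const] at hc
  rw [partEntropy_eq_integral (hξ.prodMk (measurable_word N)),
    partEntropy_eq_integral (measurable_word N), integral_congr_ae hc,
    integral_add (integrable_condInfo bot_le (measurable_word N))
      (integrable_condInfo (hf.prodMk (measurable_word N)).comap_le hξ), add_sub_cancel_left]

/-- The **Kolmogorov–Sinai theorem** for the generator `𝒫`, with the entropy expressed as the
conditional entropy of `𝒫` given the future. -/
theorem measureEntropy_leftShift (hm : MeasurePreserving leftShift m m) :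
    measureEntropy leftShift m = ((condEntropy (MeasurableSpace.comap leftShift MeasurableSpace.pi)
      m firstSymbol : ℝ) : EReal) := by
  have hword := tendsto_partEntropy_word hm
  apply le_antisymm
  · refine iSup_le fun k => iSup_le fun ξ => iSup_le fun hξ => ?_
    -- For fixed `N` the extra `N` symbols do not affect the rate; the error left over tends to zero
    -- with `N`.
    have hN : ∀ N : ℕ, limsup (fun n : ℕ =>
        ((partEntropy m (joinPartition leftShift ξ n) / n : ℝ) : EReal)) atTop ≤
        ((condEntropy (MeasurableSpace.comap leftShift MeasurableSpace.pi) m firstSymbol +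
          (partEntropy m (fun x => (ξ x, joinPartition leftShift firstSymbol N x)) -
            partEntropy m (joinPartition leftShift firstSymbol N)) : ℝ) : EReal) := by
      intro N
      set c := partEntropy m (fun x => (ξ x, joinPartition leftShift firstSymbol N x)) -
            partEntropy m (joinPartition leftShift firstSymbol N) with hc
      have h1 : Tendsto (fun n : ℕ => ((n + N : ℕ) : ℝ) * (n : ℝ)⁻¹) atTop (𝓝 1) := by
        have h3 : Tendsto (fun n : ℕ => 1 + (N : ℝ) * (n : ℝ)⁻¹) atTop (𝓝 (1 + N * 0)) :=
          tendsto_const_nhds.add (tendsto_const_nhds.mul tendsto_inv_atTop_nhds_zero_nat)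
        rw [mul_zero, add_zero] at h3
        refine h3.congr' ?_
        filter_upwards [eventually_ge_atTop 1] with n hn
        have : (n : ℝ) ≠ 0 := by exact_mod_cast (by omega : n ≠ 0)
        push_cast
        field_simp
      have h2 := ((h1.mul (hword.comp (tendsto_add_atTop_nat N))).add_const c)
      rw [one_mul] at h2
      have h3 := ((continuous_coe_real_ereal.tendsto _).comp h2).limsup_eq
      rw [condEntropy, ← h3]
      refine limsup_le_limsup ?_
      filter_upwards [eventually_ge_atTop 1] with n hn
      have hn0 : (0 : ℝ) < n := by exact_mod_cast (by omega : 0 < n)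
      have hnN : ((n + N : ℕ) : ℝ) ≠ 0 := by exact_mod_cast (by omega : n + N ≠ 0)
      refine EReal.coe_le_coe_iff.2 ?_
      have h4 := partEntropy_joinPartition_le hm hξ n N
      rw [div_le_iff₀ hn0]
      refine h4.trans (le_of_eq ?_)
      simp only [Function.comp_apply, ← hc]
      field_simp
    have hlim := (tendsto_partEntropy_prodMk_sub (m := m) hξ).const_add
      (condEntropy (MeasurableSpace.comap leftShift MeasurableSpace.pi) m firstSymbol)
    rw [add_zero] at hlim
    exact ge_of_tendsto' ((continuous_coe_real_ereal.tendsto _).comp hlim) hN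
  · refine le_trans (le_of_eq ?_) (le_iSup_of_le ℓ (le_iSup_of_le firstSymbol
      (le_iSup_of_le measurable_firstSymbol le_rfl)))
    exact (((continuous_coe_real_ereal.tendsto _).comp hword).limsup_eq).symm

end KolmogorovSinai

/-! ### The coding map: equivariance, measurability and shift compatibility. -/

namespace IFS

variable {d ℓ : ℕ}

theorem comp_succ' (Φ : IFS d ℓ) (x : ℕ → Fin ℓ) (n : ℕ) (a : Φ.X) :
    Φ.comp x (n + 1) a = Φ.S (x 0) (Φ.comp (leftShift x) n a) := by
  induction n generalizing a with
  | zero => rfl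
  | succ n ih =>
    change Φ.comp x (n + 1) (Φ.S (x (n + 1)) a) = _
    rw [ih]
    rfl

theorem continuous_S (Φ : IFS d ℓ) (i : Fin ℓ) : Continuous (Φ.S i) :=
  (Φ.contracting i).choose_spec.toLipschitzWith.continuous

theorem S_mem_attractor (Φ : IFS d ℓ) (i : Fin ℓ) {z : Φ.X} (hz : z ∈ Φ.attractor) :
    Φ.S i z ∈ Φ.attractor := by
  rw [Φ.attractor_spec.2.2]
  exact mem_iUnion.2 ⟨i, z, hz, rfl⟩

theorem comp_mem_attractor (Φ : IFS d ℓ) (x : ℕ → Fin ℓ) (n : ℕ) {z : Φ.X}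
    (hz : z ∈ Φ.attractor) : Φ.comp x n z ∈ Φ.attractor := by
  induction n generalizing z with
  | zero => exact hz
  | succ n ih => exact ih (Φ.S_mem_attractor _ hz)

/-- The canonical projection, as a point of `X`. -/
noncomputable def projX (Φ : IFS d ℓ) (x : ℕ → Fin ℓ) : Φ.X :=
  (Φ.exists_iInter_comp_eq_singleton x).choose

theorem iInter_comp_eq (Φ : IFS d ℓ) (x : ℕ → Fin ℓ) :
    ⋂ n : ℕ, Φ.comp x (n + 1) '' Φ.attractor = {Φ.projX x} :=
  (Φ.exists_iInter_comp_eq_singleton x).choose_spec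

theorem projX_mem (Φ : IFS d ℓ) (x : ℕ → Fin ℓ) (n : ℕ) :
    Φ.projX x ∈ Φ.comp x (n + 1) '' Φ.attractor := by
  have h : Φ.projX x ∈ ⋂ n : ℕ, Φ.comp x (n + 1) '' Φ.attractor := by
    rw [iInter_comp_eq]; rfl
  exact mem_iInter.1 h n

theorem projX_mem_attractor (Φ : IFS d ℓ) (x : ℕ → Fin ℓ) : Φ.projX x ∈ Φ.attractor := by
  obtain ⟨a, ha, h⟩ := Φ.projX_mem x 0
  rw [← h]
  exact Φ.comp_mem_attractor x 1 ha

/-- `S_{x_1}` carries the nested sets that define the point of `σ x` into those that define the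
point of `x`. -/
theorem projX_eq_S (Φ : IFS d ℓ) (x : ℕ → Fin ℓ) :
    Φ.projX x = Φ.S (x 0) (Φ.projX (leftShift x)) := by
  have h : Φ.S (x 0) (Φ.projX (leftShift x)) ∈ ⋂ n : ℕ, Φ.comp x (n + 1) '' Φ.attractor := by
    refine mem_iInter.2 fun n => ?_
    cases n with
    | zero => exact ⟨_, Φ.projX_mem_attractor (leftShift x), rfl⟩
    | succ n =>
      obtain ⟨a, ha, h⟩ := Φ.projX_mem (leftShift x) n
      exact ⟨a, ha, by rw [comp_succ', h]⟩
  rw [iInter_comp_eq] at h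
  exact h.symm

theorem measurable_comp (Φ : IFS d ℓ) (n : ℕ) (a : Φ.X) :
    Measurable fun x : ℕ → Fin ℓ => Φ.comp x n a := by
  induction n with
  | zero => exact measurable_const
  | succ n ih =>
    simp only [comp_succ']
    have h : Measurable fun p : Fin ℓ × Φ.X => Φ.S p.1 p.2 :=
      measurable_from_prod_countable_right fun i => (Φ.continuous_S i).measurable
    exact h.comp ((measurable_pi_apply 0).prodMk (ih.comp measurable_leftShift))

theorem lipschitzWith_comp (Φ : IFS d ℓ) {c : ℝ≥0} (hS : ∀ i, LipschitzWith c (Φ.S i))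
    (x : ℕ → Fin ℓ) (n : ℕ) : LipschitzWith (c ^ n) (Φ.comp x n) := by
  induction n with
  | zero => simpa [comp] using LipschitzWith.id
  | succ n ih => rw [pow_succ]; exact ih.comp (hS (x n))

theorem tendsto_comp_projX (Φ : IFS d ℓ) {a : Φ.X} (ha : a ∈ Φ.attractor) (x : ℕ → Fin ℓ) :
    Tendsto (fun n => Φ.comp x (n + 1) a) atTop (𝓝 (Φ.projX x)) := by
  obtain ⟨c, hc, hS⟩ := Φ.exists_ratio
  rw [tendsto_iff_edist_tendsto_0]
  have htop : Metric.ediam Φ.attractor ≠ ⊤ := Φ.attractor_spec.2.1.isBounded.ediam_ne_top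
  have hlim : Tendsto (fun n : ℕ => (c : ℝ≥0∞) ^ (n + 1) * Metric.ediam Φ.attractor) atTop
      (𝓝 (0 * Metric.ediam Φ.attractor)) := by
    refine ENNReal.Tendsto.mul_const ?_ (Or.inr htop)
    exact (ENNReal.tendsto_pow_atTop_nhds_zero_of_lt_one (by exact_mod_cast hc)).comp
      (tendsto_add_atTop_nat 1)
  rw [zero_mul] at hlim
  refine tendsto_of_tendsto_of_tendsto_of_le_of_le tendsto_const_nhds hlim (fun _ => bot_le)
    fun n => ?_
  obtain ⟨b, hb, h⟩ := Φ.projX_mem x n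
  rw [← h]
  refine (Φ.lipschitzWith_comp hS x (n + 1) a b).trans ?_
  push_cast
  gcongr
  exact Metric.edist_le_ediam_of_mem ha hb

theorem measurable_projX (Φ : IFS d ℓ) : Measurable Φ.projX := by
  obtain ⟨a, ha⟩ := Φ.attractor_spec.1
  exact measurable_of_tendsto_metrizable (fun n => Φ.measurable_comp (n + 1) a)
    (tendsto_pi_nhds.2 fun x => Φ.tendsto_comp_projX ha x)

theorem measurable_proj (Φ : IFS d ℓ) : Measurable Φ.proj :=
  measurable_subtype_coe.comp Φ.measurable_projX

/-- One direction is `S_i`, the other its inverse, both extended to Borel maps of `ℝ^d`. Injectivity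
of the maps enters the argument here. -/
theorem shiftCompatible_proj (Φ : IFS d ℓ) (hinj : ∀ i, Function.Injective (Φ.S i)) :
    ShiftCompatible Φ.proj := by
  have hX : MeasurableSet Φ.X := Φ.isClosed_X.measurableSet
  have hcoe : MeasurableEmbedding (Subtype.val : Φ.X → EuclideanSpace ℝ (Fin d)) :=
    MeasurableEmbedding.subtype_coe hX
  have : PolishSpace Φ.X := Φ.isClosed_X.polishSpace
  have hne : EuclideanSpace ℝ (Fin d) → Nonempty (EuclideanSpace ℝ (Fin d)) := fun _ => ⟨0⟩
  refine ⟨Φ.measurable_proj, fun i => ?_, fun i => ?_⟩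
  · obtain ⟨R, hR, h⟩ := hcoe.exists_measurable_extend
      (measurable_subtype_coe.comp (Φ.continuous_S i).measurable) hne
    refine ⟨R, hR, fun x hx => ?_⟩
    have h1 := congrFun h (Φ.projX (leftShift x))
    change (Φ.projX x : EuclideanSpace ℝ (Fin d)) = R (Φ.projX (leftShift x))
    rw [projX_eq_S]
    change x 0 = i at hx
    rw [hx]
    exact h1.symm
  -- By the Lusin–Souslin theorem an injective continuous map on a Polish space has a Borel inverse
  -- on its image.
  · have hemb : MeasurableEmbedding fun z : Φ.X => (Φ.S i z : EuclideanSpace ℝ (Fin d)) :=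
      (continuous_subtype_val.comp (Φ.continuous_S i)).measurableEmbedding
        (Subtype.val_injective.comp (hinj i))
    obtain ⟨R, hR, h⟩ := hemb.exists_measurable_extend measurable_subtype_coe hne
    refine ⟨R, hR, fun x hx => ?_⟩
    have h1 := congrFun h (Φ.projX (leftShift x))
    change (Φ.projX (leftShift x) : EuclideanSpace ℝ (Fin d)) = R (Φ.projX x)
    rw [projX_eq_S Φ x]
    change x 0 = i at hx
    rw [hx]
    exact h1.symm

end IFS

/-! ### Hausdorff dimension in the symbolic metric through masses of cylinders. -/

section SymbolicMetric

variable {ℓ : ℕ}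

theorem mem_word_preimage_iff {n : ℕ} {x y : ℕ → Fin ℓ} :
    y ∈ joinPartition leftShift firstSymbol n ⁻¹' {joinPartition leftShift firstSymbol n x} ↔
      ∀ i < n, y i = x i := by
  simp only [mem_preimage, mem_singleton_iff, joinPartition_leftShift, funext_iff]
  exact ⟨fun h i hi => h ⟨i, hi⟩, fun h i => h i i.2⟩

theorem symbolicMetric_dist_of_ne {x y : ℕ → Fin ℓ} (h : x ≠ y) :
    (symbolicMetric ℓ).dist x y = ((ℓ : ℝ)⁻¹) ^ PiNat.firstDiff x y := if_neg h

theorem symbolicMetric_dist_le {n : ℕ} {x y : ℕ → Fin ℓ} (h : ∀ i < n, y i = x i) :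
    (symbolicMetric ℓ).dist x y ≤ ((ℓ : ℝ)⁻¹) ^ n := by
  have hℓ : 0 < ℓ := (Nat.zero_le _).trans_lt (x 0).2
  by_cases hxy : x = y
  · subst hxy
    rw [(symbolicMetric ℓ).dist_self]
    positivity
  · rw [symbolicMetric_dist_of_ne hxy]
    refine pow_le_pow_of_le_one (by positivity) (inv_le_one_of_one_le₀ (by exact_mod_cast hℓ)) ?_
    by_contra! hlt
    exact PiNat.apply_firstDiff_ne hxy (h _ hlt).symm

theorem eq_of_symbolicMetric_dist_lt {i : ℕ} {x y : ℕ → Fin ℓ}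
    (h : (symbolicMetric ℓ).dist x y < ((ℓ : ℝ)⁻¹) ^ i) : x i = y i := by
  have hℓ : 0 < ℓ := (Nat.zero_le _).trans_lt (x 0).2
  by_cases hxy : x = y
  · rw [hxy]
  · rw [symbolicMetric_dist_of_ne hxy] at h
    refine PiNat.apply_eq_of_lt_firstDiff (not_le.1 fun hle => not_le.2 h ?_)
    exact pow_le_pow_of_le_one (by positivity) (inv_le_one_of_one_le₀ (by exact_mod_cast hℓ)) hle

theorem tendsto_inv_natCast_pow (hℓ : 2 ≤ ℓ) :
    Tendsto (fun n : ℕ => ((ℓ : ℝ)⁻¹) ^ n) atTop (𝓝 0) := by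
  have h2 : (2 : ℝ) ≤ ℓ := by exact_mod_cast hℓ
  exact tendsto_pow_atTop_nhds_zero_of_lt_one (by positivity) (inv_lt_one_of_one_lt₀ (by linarith))

theorem exists_forall_symbolicMetric_dist_lt {r : ℝ} (hr : 0 < r) :
    ∃ n : ℕ, ∀ x y : ℕ → Fin ℓ, (∀ i < n, y i = x i) → (symbolicMetric ℓ).dist x y < r := by
  rcases Nat.lt_or_ge ℓ 2 with hℓ | hℓ
  -- For `ℓ = 1` the powers of `ℓ⁻¹` do not tend to zero, but the space is a single point.
  · have : Subsingleton (Fin ℓ) := Fin.subsingleton_iff_le_one.2 (by omega)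
    refine ⟨0, fun x y _ => ?_⟩
    rw [Subsingleton.elim x y, (symbolicMetric ℓ).dist_self]
    exact hr
  · obtain ⟨n, hn⟩ := ((tendsto_inv_natCast_pow hℓ).eventually_lt_const hr).exists
    exact ⟨n, fun x y h => (symbolicMetric_dist_le h).trans_lt hn⟩

/-- The Borel sets of the symbolic metric are the product measurable sets. -/
theorem borelSpace_symbolicMetric (ℓ : ℕ) :
    @BorelSpace (ℕ → Fin ℓ) (symbolicMetric ℓ).toUniformSpace.toTopologicalSpace
      MeasurableSpace.pi := by
  let := symbolicMetric ℓ
  refine @BorelSpace.mk _ (symbolicMetric ℓ).toUniformSpace.toTopologicalSpace MeasurableSpace.pi (le_antisymm ?_ ?_)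
  · refine iSup_le fun i => ?_
    rintro _ ⟨S, -, rfl⟩
    refine MeasurableSpace.measurableSet_generateFrom ?_
    refine (Metric.isOpen_iff (α := ℕ → Fin ℓ)).2 fun x hx => ?_
    have hℓ : 0 < ℓ := (Nat.zero_le _).trans_lt (x 0).2
    refine ⟨((ℓ : ℝ)⁻¹) ^ i, by positivity, fun y hy => ?_⟩
    have := eq_of_symbolicMetric_dist_lt (Metric.mem_ball.1 hy)
    change y i ∈ S
    rw [this]
    exact hx
  · refine MeasurableSpace.generateFrom_le fun U hU => ?_
    have hU' : U = ⋃ n : ℕ, ⋃ w : Fin n → Fin ℓ,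
        ⋃ _ : joinPartition leftShift firstSymbol n ⁻¹' {w} ⊆ U,
          joinPartition leftShift firstSymbol n ⁻¹' {w} := by
      refine Subset.antisymm (fun x hx => ?_) (iUnion_subset fun n => iUnion_subset fun w =>
        iUnion_subset fun h => h)
      obtain ⟨r, hr, hball⟩ := (Metric.isOpen_iff (α := ℕ → Fin ℓ)).1 hU x hx
      obtain ⟨n, hn⟩ := exists_forall_symbolicMetric_dist_lt (ℓ := ℓ) hr
      refine mem_iUnion.2 ⟨n, mem_iUnion.2 ⟨joinPartition leftShift firstSymbol n x,
        mem_iUnion.2 ⟨fun y hy => hball ?_, rfl⟩⟩⟩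
      rw [Metric.mem_ball, dist_comm]
      exact hn x y (mem_word_preimage_iff.1 hy)
    rw [hU']
    exact MeasurableSet.iUnion fun n => MeasurableSet.iUnion fun w => MeasurableSet.iUnion fun _ =>
      measurable_word n (measurableSet_singleton w)

theorem symbolicDimH_mono {A B : Set (ℕ → Fin ℓ)} (h : A ⊆ B) : symbolicDimH A ≤ symbolicDimH B :=
  let := symbolicMetric ℓ
  dimH_mono h

theorem symbolicDimH_of_subsingleton {A : Set (ℕ → Fin ℓ)} (h : A.Subsingleton) :
    symbolicDimH A = 0 :=
  let := symbolicMetric ℓ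
  dimH_subsingleton h

/-- For fixed `N`, cover by the `n`-cylinders that meet the set. Their diameters to the power `s`
are at most their masses, and the cylinders are disjoint, so the `s`-dimensional Hausdorff measure
is at most `1`. Then take the countable union over `N`. -/
theorem symbolicDimH_le_of_measure_word_ge (hℓ : 2 ≤ ℓ) (μ : Measure (ℕ → Fin ℓ))
    [IsProbabilityMeasure μ] {A : Set (ℕ → Fin ℓ)} {s : ℝ≥0}
    (h : ∀ y ∈ A, ∃ N : ℕ, ∀ n ≥ N, ENNReal.ofReal (((ℓ : ℝ)⁻¹) ^ n) ^ (s : ℝ) ≤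
      μ (joinPartition leftShift firstSymbol n ⁻¹' {joinPartition leftShift firstSymbol n y})) :
    symbolicDimH A ≤ s := by
  let := symbolicMetric ℓ
  have := borelSpace_symbolicMetric ℓ
  classical
  change dimH A ≤ s
  set AN : ℕ → Set (ℕ → Fin ℓ) := fun N => {y | ∀ n ≥ N,
    ENNReal.ofReal (((ℓ : ℝ)⁻¹) ^ n) ^ (s : ℝ) ≤
      μ (joinPartition leftShift firstSymbol n ⁻¹' {joinPartition leftShift firstSymbol n y})}
    with hAN
  have hA : A ⊆ ⋃ N, AN N := fun y hy => mem_iUnion.2 (h y hy)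
  refine (dimH_mono hA).trans ?_
  rw [dimH_iUnion]
  refine iSup_le fun N => dimH_le_of_hausdorffMeasure_ne_top (ne_top_of_le_ne_top ENNReal.one_ne_top
    ((Measure.hausdorffMeasure_le_liminf_sum (l := atTop)
      (ι := fun n : ℕ => {w : Fin n → Fin ℓ // (AN N ∩
        joinPartition leftShift firstSymbol n ⁻¹' {w}).Nonempty}) s (AN N)
      (fun n : ℕ => ENNReal.ofReal (((ℓ : ℝ)⁻¹) ^ n)) ?_
      (fun n w => joinPartition leftShift firstSymbol n ⁻¹' {w.1}) ?_ ?_).trans ?_))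
  · simpa using ENNReal.tendsto_ofReal (tendsto_inv_natCast_pow hℓ)
  · refine Eventually.of_forall fun n w => Metric.ediam_le fun x hx y hy => ?_
    rw [edist_dist]
    refine ENNReal.ofReal_le_ofReal (symbolicMetric_dist_le fun i hi => ?_)
    have hxy : y ∈ joinPartition leftShift firstSymbol n ⁻¹'
        {joinPartition leftShift firstSymbol n x} := by
      rw [mem_preimage, mem_singleton_iff] at hx hy ⊢
      rw [hx, hy]
    exact mem_word_preimage_iff.1 hxy i hi
  · exact Eventually.of_forall fun n y hy =>
      mem_iUnion.2 ⟨⟨joinPartition leftShift firstSymbol n y, y, hy, rfl⟩, rfl⟩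
  · have hle : ∀ᶠ n : ℕ in atTop, ∑ w : {w : Fin n → Fin ℓ // (AN N ∩
        joinPartition leftShift firstSymbol n ⁻¹' {w}).Nonempty},
        Metric.ediam (joinPartition leftShift firstSymbol n ⁻¹' {w.1}) ^ (s : ℝ) ≤ 1 := by
      filter_upwards [eventually_ge_atTop N] with n hn
      calc _ ≤ ∑ w : {w : Fin n → Fin ℓ // (AN N ∩
            joinPartition leftShift firstSymbol n ⁻¹' {w}).Nonempty},
            μ (joinPartition leftShift firstSymbol n ⁻¹' {w.1}) := by
            refine Finset.sum_le_sum fun w _ => ?_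
            obtain ⟨y, hyA, hyw⟩ := w.2
            rw [mem_preimage, mem_singleton_iff] at hyw
            rw [← hyw]
            refine le_trans (ENNReal.rpow_le_rpow (Metric.ediam_le fun x hx z hz => ?_) s.2)
              (hyA n hn)
            rw [edist_dist]
            refine ENNReal.ofReal_le_ofReal (symbolicMetric_dist_le fun i hi => ?_)
            rw [mem_word_preimage_iff.1 hx i hi, mem_word_preimage_iff.1 hz i hi]
        _ = μ (⋃ w : {w : Fin n → Fin ℓ // (AN N ∩
            joinPartition leftShift firstSymbol n ⁻¹' {w}).Nonempty},
            joinPartition leftShift firstSymbol n ⁻¹' {w.1}) := by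
            rw [measure_iUnion _ fun w => measurable_word n (measurableSet_singleton _),
              tsum_fintype]
            intro v w hvw
            refine Disjoint.preimage _ ?_
            simpa [Subtype.ext_iff] using hvw
        _ ≤ 1 := prob_le_one
    exact (liminf_le_liminf hle).trans (by rw [liminf_const])

/-- Mass distribution principle: a small set meeting `A` lies in a cylinder of comparable diameter,
so `μ` restricted to `A` is at most the `s`-dimensional Hausdorff measure. -/
theorem le_symbolicDimH_of_measure_word_le (hℓ : 2 ≤ ℓ) (μ : Measure (ℕ → Fin ℓ))
    {A : Set (ℕ → Fin ℓ)} (hA : MeasurableSet A) (hA0 : μ A ≠ 0) {s : ℝ≥0} (hs : 0 < s) {N : ℕ}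
    (h : ∀ y ∈ A, ∀ n ≥ N,
      μ (joinPartition leftShift firstSymbol n ⁻¹' {joinPartition leftShift firstSymbol n y}) ≤
        ENNReal.ofReal (((ℓ : ℝ)⁻¹) ^ n) ^ (s : ℝ)) :
    (s : ℝ≥0∞) ≤ symbolicDimH A := by
  let := symbolicMetric ℓ
  have := borelSpace_symbolicMetric ℓ
  change _ ≤ dimH A
  have h2 : (2 : ℝ) ≤ ℓ := by exact_mod_cast hℓ
  have hρ0 : 0 < (ℓ : ℝ)⁻¹ := by positivity
  have hρ1 : (ℓ : ℝ)⁻¹ < 1 := inv_lt_one_of_one_lt₀ (by linarith)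
  have hle : μ.restrict A ≤ Measure.hausdorffMeasure (s : ℝ) := by
    refine Measure.le_hausdorffMeasure _ _ (ENNReal.ofReal (((ℓ : ℝ)⁻¹) ^ N))
      (ENNReal.ofReal_pos.2 (by positivity)) fun U hU => ?_
    rw [Measure.restrict_apply' hA]
    rcases (U ∩ A).eq_empty_or_nonempty with he | ⟨y, hyU, hyA⟩
    · rw [he]; simp
    by_cases hsing : ∀ z ∈ U, z = y
    · refine le_trans ?_ bot_le
      have hlim : Tendsto (fun n : ℕ => ENNReal.ofReal (((ℓ : ℝ)⁻¹) ^ n) ^ (s : ℝ)) atTop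
          (𝓝 0) := by
        have h1 := ENNReal.tendsto_ofReal (tendsto_inv_natCast_pow hℓ)
        rw [ENNReal.ofReal_zero] at h1
        have h3 := (ENNReal.continuous_rpow_const (y := (s : ℝ))).tendsto 0 |>.comp h1
        rwa [ENNReal.zero_rpow_of_pos (by exact_mod_cast hs)] at h3
      refine ge_of_tendsto hlim ?_
      filter_upwards [eventually_ge_atTop N] with n hn
      refine (measure_mono ?_).trans (h y hyA n hn)
      rintro z ⟨hz, -⟩
      rw [hsing z hz]
      rfl
    · push Not at hsing
      -- With `k` the least index at which a point of `U` departs from `y`, the set `U` lies in the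
      -- `k`-cylinder of `y` and has diameter at least `ℓ⁻ᵏ`.
      have hex : ∃ k, ∃ z ∈ U, z ≠ y ∧ PiNat.firstDiff y z = k := by
        obtain ⟨z, hz, hzy⟩ := hsing
        exact ⟨_, z, hz, hzy, rfl⟩
      classical
      obtain ⟨z, hz, hzy, hk⟩ := Nat.find_spec hex
      set k := Nat.find hex with hkdef
      have hdiam : ENNReal.ofReal (((ℓ : ℝ)⁻¹) ^ k) ≤ Metric.ediam U := by
        refine le_trans (le_of_eq ?_) (Metric.edist_le_ediam_of_mem hyU hz)
        rw [edist_dist, ← hk]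
        exact congrArg ENNReal.ofReal (symbolicMetric_dist_of_ne hzy.symm).symm
      have hkN : N ≤ k := by
        have h3 := (ENNReal.ofReal_le_ofReal_iff (by positivity)).1 (hdiam.trans hU)
        exact (pow_le_pow_iff_right_of_lt_one₀ hρ0 hρ1).1 h3
      refine le_trans ?_ ((h y hyA k hkN).trans (ENNReal.rpow_le_rpow hdiam s.2))
      refine measure_mono fun u hu => mem_word_preimage_iff.2 fun i hi => ?_
      by_cases huy : u = y
      · rw [huy]
      · refine (PiNat.apply_eq_of_lt_firstDiff (hi.trans_le ?_)).symm
        exact Nat.find_min' hex ⟨u, hu.1, huy, rfl⟩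
  refine le_dimH_of_hausdorffMeasure_ne_zero fun h0 => hA0 ?_
  have := hle A
  rw [h0, Measure.restrict_apply_self] at this
  exact le_antisymm this bot_le

theorem measureDimH_eq_zero_of_tendsto (hℓ : 2 ≤ ℓ) (μ : Measure (ℕ → Fin ℓ))
    [IsProbabilityMeasure μ]
    (h : ∀ᵐ y ∂μ, Tendsto (fun n : ℕ => (n : ℝ)⁻¹ * Real.log (μ.real
      (joinPartition leftShift firstSymbol n ⁻¹' {joinPartition leftShift firstSymbol n y})))
      atTop (𝓝 0)) : measureDimH μ = 0 := by
  have h2 : (2 : ℝ) ≤ ℓ := by exact_mod_cast hℓ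
  have hlog : 0 < Real.log ℓ := Real.log_pos (by linarith)
  have hpos : ∀ᵐ y ∂μ, ∀ n, 0 < μ.real
      (joinPartition leftShift firstSymbol n ⁻¹' {joinPartition leftShift firstSymbol n y}) :=
    ae_all_iff.2 fun n => ae_measureReal_cell_pos (measurable_word n)
  obtain ⟨A', hA'sub, hA'm, hA'⟩ := exists_measurable_superset_of_null (ae_iff.1 (h.and hpos))
  obtain ⟨A, rfl⟩ : ∃ A, A' = Aᶜ := ⟨A'ᶜ, (compl_compl _).symm⟩
  have hAm : MeasurableSet A := by simpa using hA'm.compl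
  have hs : ∀ s : ℝ≥0, 0 < s → measureDimH μ ≤ s := by
    intro s hs
    refine (iInf_le_of_le A (iInf_le_of_le hAm (iInf_le_of_le hA'
      (symbolicDimH_le_of_measure_word_ge hℓ μ fun y hy => ?_))))
    obtain ⟨hy1, hy2⟩ := not_not.1 fun hn => hA'sub hn hy
    have hs' : (0 : ℝ) < s := by exact_mod_cast hs
    have hev := hy1.eventually_const_lt (u := -(s * Real.log ℓ)) (by
      have := mul_pos hs' hlog
      linarith)
    obtain ⟨N, hN⟩ := eventually_atTop.1 hev
    refine ⟨N + 1, fun n hn => ?_⟩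
    have hn0 : (0 : ℝ) < n := by exact_mod_cast (by omega : 0 < n)
    have h3 := hN n (by omega)
    rw [← ofReal_measureReal, ENNReal.ofReal_rpow_of_pos (by positivity)]
    refine ENNReal.ofReal_le_ofReal ?_
    rw [← Real.log_le_log_iff (by positivity) (hy2 n), Real.log_rpow (by positivity), Real.log_pow,
      Real.log_inv]
    rw [← div_eq_inv_mul, lt_div_iff₀ hn0] at h3
    linarith
  refine le_antisymm (ENNReal.le_of_forall_pos_le_add fun s hs0 _ => ?_) bot_le
  rw [zero_add]
  exact hs s hs0

/-- If `L y > s log ℓ`, then from some `N` on the cylinders of `y` have mass at most `ℓ^(-ns)`. For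
each `N` such points form a null set: otherwise every set of full measure would have dimension at
least `s`. -/
theorem ae_limit_nonpos_of_measureDimH_eq_zero (hℓ : 2 ≤ ℓ) (μ : Measure (ℕ → Fin ℓ))
    [IsProbabilityMeasure μ] {L : (ℕ → Fin ℓ) → ℝ}
    (h : ∀ᵐ y ∂μ, Tendsto (fun n : ℕ => (n : ℝ)⁻¹ * -Real.log (μ.real
      (joinPartition leftShift firstSymbol n ⁻¹' {joinPartition leftShift firstSymbol n y})))
      atTop (𝓝 (L y))) (hdim : measureDimH μ = 0) : ∀ᵐ y ∂μ, L y ≤ 0 := by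
  have h2 : (2 : ℝ) ≤ ℓ := by exact_mod_cast hℓ
  have hlog : 0 < Real.log ℓ := Real.log_pos (by linarith)
  have key : ∀ s : ℝ≥0, 0 < s → ∀ᵐ y ∂μ, L y ≤ s * Real.log ℓ := by
    intro s hs
    set A : ℕ → Set (ℕ → Fin ℓ) := fun N => {y | ∀ n ≥ N,
      μ (joinPartition leftShift firstSymbol n ⁻¹' {joinPartition leftShift firstSymbol n y}) ≤
        ENNReal.ofReal (((ℓ : ℝ)⁻¹) ^ n) ^ (s : ℝ)} with hA
    have hAm : ∀ N, MeasurableSet (A N) := by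
      intro N
      have hAN : A N = ⋂ n, ⋂ _ : n ≥ N, {y | μ (joinPartition leftShift firstSymbol n ⁻¹'
          {joinPartition leftShift firstSymbol n y}) ≤
            ENNReal.ofReal (((ℓ : ℝ)⁻¹) ^ n) ^ (s : ℝ)} := by
        ext y; simp [hA]
      rw [hAN]
      refine MeasurableSet.iInter fun n => MeasurableSet.iInter fun _ => ?_
      exact measurableSet_le ((measurable_of_finite fun w : Fin n → Fin ℓ =>
        μ (joinPartition leftShift firstSymbol n ⁻¹' {w})).comp (measurable_word n))
        measurable_const
    have hA0 : ∀ N, μ (A N) = 0 := by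
      intro N
      by_contra hne
      have hlt : measureDimH μ < s := by rw [hdim]; exact_mod_cast hs
      simp only [measureDimH, iInf_lt_iff] at hlt
      obtain ⟨B, hBm, hB0, hBs⟩ := hlt
      have hBA : μ (B ∩ A N) ≠ 0 := by
        have : μ (B ∩ A N) = μ (A N) := by
          refine measure_congr ?_
          filter_upwards [measure_eq_zero_iff_ae_notMem.1 hB0] with y hy
          have hyB : y ∈ B := by simpa using hy
          simp only [eq_iff_iff]
          exact ⟨fun h => h.2, fun h => ⟨hyB, h⟩⟩
        rwa [this]
      have := le_symbolicDimH_of_measure_word_le hℓ μ (hBm.inter (hAm N)) hBA hs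
        (fun y hy n hn => hy.2 n hn)
      exact absurd (this.trans (symbolicDimH_mono inter_subset_left)) (not_le.2 hBs)
    have hA' : ∀ᵐ y ∂μ, ∀ N, y ∉ A N := ae_all_iff.2 fun N => measure_eq_zero_iff_ae_notMem.1 (hA0 N)
    filter_upwards [h, hA'] with y hy hyA
    by_contra! hlt
    obtain ⟨N, hN⟩ := eventually_atTop.1 (hy.eventually_const_lt hlt)
    refine hyA (N + 1) fun n hn => ?_
    have hn0 : (0 : ℝ) < n := by exact_mod_cast (by omega : 0 < n)
    have h3 := hN n (by omega)
    rw [← ofReal_measureReal, ENNReal.ofReal_rpow_of_pos (by positivity)]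
    refine ENNReal.ofReal_le_ofReal ?_
    rcases (measureReal_nonneg (μ := μ) (s := joinPartition leftShift firstSymbol n ⁻¹'
      {joinPartition leftShift firstSymbol n y})).eq_or_lt with h0 | h0
    · rw [← h0]; positivity
    rw [← Real.log_le_log_iff h0 (by positivity), Real.log_rpow (by positivity), Real.log_pow,
      Real.log_inv]
    rw [← div_eq_inv_mul, lt_div_iff₀ hn0] at h3
    linarith
  have hall : ∀ᵐ y ∂μ, ∀ j : ℕ, L y ≤ ((1 / ((j : ℝ≥0) + 1) : ℝ≥0) : ℝ) * Real.log ℓ :=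
    ae_all_iff.2 fun j => key _ (by positivity)
  filter_upwards [hall] with y hy
  have hlim := (tendsto_one_div_add_atTop_nhds_zero_nat (𝕜 := ℝ)).mul_const (Real.log ℓ)
  rw [zero_mul] at hlim
  refine ge_of_tendsto' hlim fun j => ?_
  simpa using hy j

end SymbolicMetric

/-! ### Disintegration along the fibres of a map. -/

section Fibres

variable {Ω E : Type*} {𝒜 : MeasurableSpace Ω} [mΩ : MeasurableSpace Ω] [StandardBorelSpace Ω] [mE : MeasurableSpace E]
variable {m : Measure Ω} [IsProbabilityMeasure m] {π : Ω → E}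

theorem ae_ae_condExpKernel (h𝒜 : 𝒜 ≤ mΩ) {p : Ω → Prop}
    (hp : ∀ᵐ y ∂m, p y) : ∀ᵐ x ∂m, ∀ᵐ y ∂condExpKernel m 𝒜 x, p y := by
  have h : ∀ᵐ y ∂(condExpKernel m 𝒜 ∘ₘ m.trim h𝒜), p y := by rwa [condExpKernel_comp_trim h𝒜]
  exact ae_of_ae_trim h𝒜 (Measure.ae_ae_of_ae_comp h)

theorem ae_of_ae_ae_condExpKernel (h𝒜 : 𝒜 ≤ mΩ) {p : Ω → Prop}
    (hp : MeasurableSet {y | p y}) (h : ∀ᵐ x ∂m, ∀ᵐ y ∂condExpKernel m 𝒜 x, p y) :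
    ∀ᵐ y ∂m, p y := by
  have h0 : m {y | p y}ᶜ = 0 := by
    conv_lhs => rw [← condExpKernel_comp_trim (μ := m) h𝒜]
    rw [Measure.bind_apply hp.compl (condExpKernel m 𝒜).aemeasurable,
      lintegral_trim h𝒜 (measurable_condExpKernel hp.compl)]
    exact lintegral_eq_zero_of_ae_eq_zero (h.mono fun x hx => hx)
  exact h0

/-- Almost every conditional measure given `π` is carried by the fibre of `π`. -/
theorem ae_ae_condExpKernel_comap_eq [MeasurableEq E] (hπ : Measurable π) :
    ∀ᵐ x ∂m, ∀ᵐ y ∂condExpKernel m (mE.comap π) x, π x = π y := by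
  have hle := hπ.comap_le
  have hmeas : @MeasurableSet (Ω × Ω) ((mE.comap π).prod mΩ) {p | π p.1 = π p.2} := by
    have h1 : @Measurable (Ω × Ω) E ((mE.comap π).prod mΩ) mE fun p => π p.1 :=
      (comap_measurable π).comp (@measurable_fst Ω Ω (mE.comap π) mΩ)
    have h2 : @Measurable (Ω × Ω) E ((mE.comap π).prod mΩ) mE fun p => π p.2 :=
      hπ.comp (@measurable_snd Ω Ω (mE.comap π) mΩ)
    exact @measurableSet_eq_fun _ _ ((mE.comap π).prod mΩ) _ _ _ _ h1 h2
  have hdiag : @Measurable Ω (Ω × Ω) mΩ ((mE.comap π).prod mΩ) Function.diag :=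
    @Measurable.prodMk Ω mΩ Ω Ω (mE.comap π) mΩ id id (measurable_id'' hle) measurable_id
  -- Drawing `x` and then `y` from its conditional measure gives the law of the diagonal, provided
  -- the first coordinate is seen only through `π`.
  have hae : ∀ᵐ p ∂((m.trim hle) ⊗ₘ condExpKernel m (mE.comap π)), π p.1 = π p.2 := by
    rw [compProd_trim_condExpKernel hle]
    rw [@ae_map_iff Ω (Ω × Ω) mΩ ((mE.comap π).prod mΩ) m Function.diag
      ⟨_, hdiag, ae_eq_refl _⟩ _ hmeas]
    exact ae_of_all _ fun _ => rfl
  exact ae_of_ae_trim hle (Measure.ae_ae_of_ae_compProd hae)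

/-- The kernel evaluated on a set is measurable for `π`, hence a function of `π`. So this holds for
every pair, with no exceptional set. -/
theorem condExpKernel_comap_congr {x y : Ω} (h : π x = π y) :
    condExpKernel m (mE.comap π) x = condExpKernel m (mE.comap π) y := by
  ext s hs
  obtain ⟨φ, -, hφ⟩ := (measurable_condExpKernel (μ := m) (m := mE.comap π) hs).exists_eq_measurable_comp
  exact (congrFun hφ x).trans ((congrArg φ h).trans (congrFun hφ y).symm)

end Fibres

/-! ### The decay rate along fibres, and the equivalences. -/

section Main

variable {d ℓ : ℕ} (Φ : IFS d ℓ) (m : Measure (ℕ → Fin ℓ))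

/-- The exponential decay rate of `m_x^η (𝒫_0^k (x))`. -/
noncomputable def fibreRate (x : ℕ → Fin ℓ) : ℝ :=
  (m[fun x => infoDefect m Φ.proj x + condInfo (MeasurableSpace.comap leftShift
    MeasurableSpace.pi) m firstSymbol x | MeasurableSpace.invariants leftShift]) x

theorem measurable_fibreRate : Measurable (fibreRate Φ m) :=
  stronglyMeasurable_condExp.measurable.mono (MeasurableSpace.invariants_le _) le_rfl

variable [IsProbabilityMeasure m]

theorem fibreMeasure_eq (x : ℕ → Fin ℓ) :
    fibreMeasure Φ m x = condExpKernel m (MeasurableSpace.comap Φ.proj inferInstance) x := by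
  rw [fibreMeasure, ← BorelSpace.measurable_eq]

instance isProbabilityMeasure_fibreMeasure (x : ℕ → Fin ℓ) :
    IsProbabilityMeasure (fibreMeasure Φ m x) := by
  rw [fibreMeasure]
  have : Nonempty (ℕ → Fin ℓ) := ⟨x⟩
  infer_instance

theorem integral_fibreRate : ∫ x, fibreRate Φ m x ∂m =
    condEntropy (MeasurableSpace.comap leftShift MeasurableSpace.pi) m firstSymbol -
      projEntropy Φ m := by
  have hproj := Φ.measurable_proj
  have hi : Integrable (condInfo (MeasurableSpace.comap leftShift MeasurableSpace.pi) m
      (firstSymbol (ℓ := ℓ))) m := integrable_condInfo measurable_leftShift.comap_le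
        measurable_firstSymbol
  have h := integral_condExp (μ := m) (MeasurableSpace.invariants_le (leftShift (ℓ := ℓ)))
    (f := fun x => infoDefect m Φ.proj x + condInfo (MeasurableSpace.comap leftShift
      MeasurableSpace.pi) m firstSymbol x)
  rw [integral_add (integrable_infoDefect hproj) hi] at h
  refine h.trans ?_
  rw [projEntropy, ← BorelSpace.measurable_eq]
  simp only [infoDefect, condEntropy]
  rw [integral_sub (integrable_condInfo hproj.comap_le measurable_firstSymbol)
    (integrable_condInfo (hproj.comp measurable_leftShift).comap_le measurable_firstSymbol)]
  ring

theorem projEntropy_eq_iff_integral (hm : MeasurePreserving leftShift m m) :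
    ((projEntropy Φ m : ℝ) : EReal) = measureEntropy leftShift m ↔
      ∫ x, fibreRate Φ m x ∂m = 0 := by
  rw [measureEntropy_leftShift hm, EReal.coe_eq_coe_iff, integral_fibreRate, sub_eq_zero]
  exact eq_comm

theorem ae_condInfo_eq_neg_log_fibreMeasure : ∀ᵐ x ∂m, ∀ n,
    condInfo (MeasurableSpace.comap Φ.proj inferInstance) m
      (joinPartition leftShift firstSymbol n) x = -Real.log ((fibreMeasure Φ m x).real
        (joinPartition leftShift firstSymbol n ⁻¹'
          {joinPartition leftShift firstSymbol n x})) := by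
  have h : ∀ᵐ x ∂m, ∀ (n : ℕ) (w : Fin n → Fin ℓ), (fibreMeasure Φ m x).real
      (joinPartition leftShift firstSymbol n ⁻¹' {w}) =
      (m⟦joinPartition leftShift firstSymbol n ⁻¹' {w}|MeasurableSpace.comap Φ.proj
        inferInstance⟧) x := by
    refine ae_all_iff.2 fun n => ae_all_iff.2 fun w => ?_
    simp only [fibreMeasure_eq]
    exact condExpKernel_ae_eq_condExp Φ.measurable_proj.comap_le
      (measurable_word n (measurableSet_singleton w))
  filter_upwards [h] with x hx n
  rw [condInfo_apply, hx]

variable {m}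

theorem tendsto_log_fibreMeasure (hinj : ∀ i, Function.Injective (Φ.S i))
    (hm : MeasurePreserving leftShift m m) : ∀ᵐ x ∂m, Tendsto (fun n : ℕ => (n : ℝ)⁻¹ *
      -Real.log ((fibreMeasure Φ m x).real (joinPartition leftShift firstSymbol n ⁻¹'
        {joinPartition leftShift firstSymbol n x}))) atTop (𝓝 (fibreRate Φ m x)) := by
  filter_upwards [tendsto_condInfo_word hm (Φ.shiftCompatible_proj hinj),
    ae_condInfo_eq_neg_log_fibreMeasure Φ m] with x h1 h2
  change Tendsto _ _ (𝓝 (fibreRate Φ m x)) at h1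
  simpa only [h2] using h1

theorem fibreRate_nonneg (hinj : ∀ i, Function.Injective (Φ.S i))
    (hm : MeasurePreserving leftShift m m) : ∀ᵐ x ∂m, 0 ≤ fibreRate Φ m x := by
  filter_upwards [tendsto_log_fibreMeasure Φ hinj hm] with x hx
  refine ge_of_tendsto' hx fun n => mul_nonneg (by positivity) ?_
  rw [neg_nonneg]
  exact Real.log_nonpos measureReal_nonneg measureReal_le_one

/-- `𝒫_0^k` consists of cylinders of length `k + 1` while the normalization is `1/k`; the factor `(k
+ 1)/k` tends to `1`. At `k = 0` the division has a default value, irrelevant in the limit. -/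
theorem tendsto_log_cell_iff {a : ℕ → ℝ} {L : ℝ}
    (h : Tendsto (fun n : ℕ => (n : ℝ)⁻¹ * -a n) atTop (𝓝 L)) :
    Tendsto (fun k : ℕ => (1 / (k : ℝ)) * a (k + 1)) atTop (𝓝 0) ↔ L = 0 := by
  have hshift : Tendsto (fun k : ℕ => (1 / (k : ℝ)) * a (k + 1)) atTop (𝓝 (-L)) := by
    have h1 : Tendsto (fun k : ℕ => -(1 + (k : ℝ)⁻¹)) atTop (𝓝 (-(1 + 0))) :=
      (tendsto_const_nhds.add tendsto_inv_atTop_nhds_zero_nat).neg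
    have h2 := h1.mul (h.comp (tendsto_add_atTop_nat 1))
    rw [add_zero, neg_one_mul] at h2
    refine h2.congr' ?_
    filter_upwards [eventually_ge_atTop 1] with k hk
    have : (k : ℝ) ≠ 0 := by exact_mod_cast (by omega : k ≠ 0)
    simp only [Function.comp_apply]
    push_cast
    field_simp
  constructor
  · intro h0
    exact neg_eq_zero.1 (tendsto_nhds_unique hshift h0)
  · rintro rfl
    simpa using hshift

theorem ae_tendsto_iff_fibreRate (hinj : ∀ i, Function.Injective (Φ.S i))
    (hm : MeasurePreserving leftShift m m) :
    (∀ᵐ x ∂m, Tendsto (fun k : ℕ => (1 / (k : ℝ)) * Real.log ((fibreMeasure Φ m x).real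
        (partitionCell (joinPartition leftShift firstSymbol (k + 1)) x))) atTop (𝓝 0)) ↔
      ∀ᵐ x ∂m, fibreRate Φ m x = 0 := by
  refine eventually_congr ?_
  filter_upwards [tendsto_log_fibreMeasure Φ hinj hm] with x hx
  exact tendsto_log_cell_iff (a := fun n => Real.log ((fibreMeasure Φ m x).real
    (joinPartition leftShift firstSymbol n ⁻¹' {joinPartition leftShift firstSymbol n x}))) hx

/-- The rate along almost every fibre, seen from a fixed conditional measure. -/
theorem ae_ae_tendsto_log_fibreMeasure (hinj : ∀ i, Function.Injective (Φ.S i))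
    (hm : MeasurePreserving leftShift m m) :
    ∀ᵐ x ∂m, ∀ᵐ y ∂fibreMeasure Φ m x, Tendsto (fun n : ℕ => (n : ℝ)⁻¹ *
      -Real.log ((fibreMeasure Φ m x).real (joinPartition leftShift firstSymbol n ⁻¹'
        {joinPartition leftShift firstSymbol n y}))) atTop (𝓝 (fibreRate Φ m y)) := by
  have h1 := ae_ae_condExpKernel (m := m) Φ.measurable_proj.comap_le
    (tendsto_log_fibreMeasure Φ hinj hm)
  have h2 := ae_ae_condExpKernel_comap_eq (m := m) Φ.measurable_proj
  filter_upwards [h1, h2] with x hx1 hx2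
  rw [fibreMeasure_eq]
  filter_upwards [hx1, hx2] with y hy1 hy2
  -- Almost every `y` lies in the fibre of `x`, so its own conditional measure is that of `x`.
  rw [condExpKernel_comap_congr hy2]
  simpa only [fibreMeasure_eq] using hy1

theorem measureDimH_of_subsingleton [Subsingleton (ℕ → Fin ℓ)] (μ : Measure (ℕ → Fin ℓ)) :
    measureDimH μ = 0 :=
  le_antisymm ((iInf_le_of_le univ (iInf_le_of_le MeasurableSet.univ (iInf_le_of_le (by simp)
    (symbolicDimH_of_subsingleton subsingleton_univ).le)))) bot_le

theorem fibreRate_eq_zero_of_subsingleton [Subsingleton (ℕ → Fin ℓ)]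
    (hinj : ∀ i, Function.Injective (Φ.S i)) (hm : MeasurePreserving leftShift m m) :
    ∀ᵐ x ∂m, fibreRate Φ m x = 0 := by
  filter_upwards [tendsto_log_fibreMeasure Φ hinj hm] with x hx
  refine tendsto_nhds_unique hx (tendsto_const_nhds.congr fun n => ?_)
  have : joinPartition leftShift firstSymbol n ⁻¹' {joinPartition leftShift firstSymbol n x} =
      univ := eq_univ_of_forall fun y => by rw [Subsingleton.elim y x]; rfl
  rw [this]
  simp

/-- The rate may vary within a fibre, so it is compared with the dimension for almost every `y`
under each conditional measure, and the result is carried between `m` and its disintegration. -/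
theorem ae_fibreRate_eq_zero_iff_measureDimH (hinj : ∀ i, Function.Injective (Φ.S i))
    (hm : MeasurePreserving leftShift m m) :
    (∀ᵐ x ∂m, fibreRate Φ m x = 0) ↔ ∀ᵐ x ∂m, measureDimH (fibreMeasure Φ m x) = 0 := by
  rcases Nat.lt_or_ge ℓ 2 with hℓ | hℓ
  · have : Subsingleton (Fin ℓ) := Fin.subsingleton_iff_le_one.2 (by omega)
    exact ⟨fun _ => ae_of_all _ fun x => measureDimH_of_subsingleton _,
      fun _ => fibreRate_eq_zero_of_subsingleton Φ hinj hm⟩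
  have hle := Φ.measurable_proj.comap_le
  have hrate := ae_ae_tendsto_log_fibreMeasure Φ hinj hm
  constructor
  · intro h
    filter_upwards [hrate, ae_ae_condExpKernel hle h] with x h1 h2
    rw [← fibreMeasure_eq] at h2
    refine measureDimH_eq_zero_of_tendsto hℓ _ ?_
    filter_upwards [h1, h2] with y hy1 hy2
    rw [hy2] at hy1
    simpa using hy1.neg
  · intro h
    have hm0 : MeasurableSet {x | fibreRate Φ m x ≤ 0} :=
      measurableSet_le (measurable_fibreRate Φ m) measurable_const
    have hle0 : ∀ᵐ x ∂m, fibreRate Φ m x ≤ 0 := by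
      refine ae_of_ae_ae_condExpKernel hle hm0 ?_
      filter_upwards [hrate, h] with x h1 h2
      rw [← fibreMeasure_eq]
      exact ae_limit_nonpos_of_measureDimH_eq_zero hℓ _ h1 h2
    filter_upwards [hle0, fibreRate_nonneg Φ hinj hm] with x h1 h2 using le_antisymm h1 h2

theorem projEntropy_eq_iff_fibreRate (hinj : ∀ i, Function.Injective (Φ.S i))
    (hm : MeasurePreserving leftShift m m) :
    ((projEntropy Φ m : ℝ) : EReal) = measureEntropy leftShift m ↔
      ∀ᵐ x ∂m, fibreRate Φ m x = 0 := by
  rw [projEntropy_eq_iff_integral Φ m hm]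
  exact integral_eq_zero_iff_of_nonneg_ae (fibreRate_nonneg Φ hinj hm) integrable_condExp

/-- The fibre itself is a Borel set of full conditional measure. -/
theorem measureDimH_fibreMeasure_le :
    ∀ᵐ x ∂m, measureDimH (fibreMeasure Φ m x) ≤ symbolicDimH (Φ.proj ⁻¹' {Φ.proj x}) := by
  filter_upwards [ae_ae_condExpKernel_comap_eq (m := m) Φ.measurable_proj] with x hx
  rw [← fibreMeasure_eq] at hx
  refine iInf_le_of_le _ (iInf_le_of_le (Φ.measurable_proj (measurableSet_singleton _))
    (iInf_le_of_le ?_ le_rfl))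
  refine measure_eq_zero_iff_ae_notMem.2 ?_
  filter_upwards [hx] with y hy
  simpa using hy.symm

end Main

theorem mainTheorem12 {d ℓ : ℕ} (Φ : IFS d ℓ) (hinj : ∀ i, Function.Injective (Φ.S i))
    (m : Measure (ℕ → Fin ℓ)) [IsProbabilityMeasure m] (hm : MeasurePreserving leftShift m m) :
    (((projEntropy Φ m : ℝ) : EReal) = measureEntropy leftShift m ↔
      ∀ᵐ x ∂m, Tendsto (fun k : ℕ => (1 / (k : ℝ)) * Real.log ((fibreMeasure Φ m x).real
        (partitionCell (joinPartition leftShift firstSymbol (k + 1)) x))) atTop (𝓝 0)) ∧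
    ((∀ᵐ x ∂m, Tendsto (fun k : ℕ => (1 / (k : ℝ)) * Real.log ((fibreMeasure Φ m x).real
        (partitionCell (joinPartition leftShift firstSymbol (k + 1)) x))) atTop (𝓝 0)) ↔
      ∀ᵐ x ∂m, measureDimH (fibreMeasure Φ m x) = 0) ∧
    ((∀ z : EuclideanSpace ℝ (Fin d), symbolicDimH (Φ.proj ⁻¹' {z}) = 0) →
      ((projEntropy Φ m : ℝ) : EReal) = measureEntropy leftShift m) := by
  have h2 := (ae_tendsto_iff_fibreRate Φ hinj hm).trans
    (ae_fibreRate_eq_zero_iff_measureDimH Φ hinj hm)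
  refine ⟨(projEntropy_eq_iff_fibreRate Φ hinj hm).trans
    (ae_tendsto_iff_fibreRate Φ hinj hm).symm, h2, fun h => ?_⟩
  rw [projEntropy_eq_iff_fibreRate Φ hinj hm, ae_fibreRate_eq_zero_iff_measureDimH Φ hinj hm]
  filter_upwards [measureDimH_fibreMeasure_le (m := m) Φ] with x hx
  rw [h] at hx
  exact le_antisymm hx bot_le
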